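/- Let $d\ge 1$. Let $\mathcal{E}=\ell^2(\mathbb{Z}^d;\mathbb{C})\times\ell^2(\mathbb{Z}^d;\mathbb{C})$ be the complexified phase space of points $z=(u,v)$ with $\|z\|^2=\sum_j(|u_j|^2+|v_j|^2)$ and symplectic form $\sum_j(u_jv'_j-v_ju'_j)$, and for $0<R<1$ and $\mathfrak{d}\ge 0$ put $B_{R,\mathfrak{d}}=\{z\in\mathcal{E}:\|z\|<R(1-\mathfrak{d})\}$. For a holomorphic function $g$ let $X_g=(\partial_v g,-\partial_u g)$ be its Hamiltonian vector field, and let $N_{\mathfrak{d}}(g)=\sup_{B_{R,\mathfrak{d}}}|g|$ and $N^{\nabla}_{\mathfrak{d}}(g)=\frac1R\sup_{B_{R,\mathfrak{d}}}\|X_g\|$. For an integer $p\ge1$ and $\epsilon>0$ consider the scaled discrete Klein--Gordon Hamiltonian $H=G+F$, $$G=\frac12\sum_{j\in\mathbb{Z}^d}(u_j^2+v_j^2),\qquad F=\frac{\epsilon}{2p+2}\sum_{j\in\mathbb{Z}^d}u_j^{2p+2}+\frac{\epsilon}{2}\sum_{j\in\mathbb{Z}^d}\sum_{|j-h|=1}(u_j-u_h)^2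 .$$ There is a constant $C_d>0$ depending only on $d$ such that for all $0<\mathfrak{d}\le\frac14$ and $0<R<1$ there exist $\epsilon^*>0$ and $C>0$, depending only on $\mathfrak{d},d,R$, such that for every integer $p\ge 1$ and every $0<\epsilon<\epsilon^*$, with $$\omega_1=2\epsilon\,(C_d+R^{2p}),\qquad \mu=\frac{12e\pi\,\omega_1}{\mathfrak{d}}=\mathcal{O}(\epsilon),$$ the following holds. There are a canonical change of coordinates $T$ on $B_{R,\mathfrak{d}}$ (biholomorphic onto its open image, symplectic, mapping real points to real points) with $\|T(z)-z\|\le C\mu R$ on $B_{R,\mathfrak{d}}$ and $$B_{R,2\mathfrak{d}}\subset T(B_{R,\mathfrak{d}})\subset B_{R,0},\qquad B_{R,3\mathfrak{d}}\subset T(B_{R,2\mathfrak{d}})\subset B_{R,\mathfrak{d}},$$ and holomorphic functions $Z,\mathcal{P}$ on $B_{R,\mathfrak{d}}$, with $Z$ real at real points, such that on $B_{R,\mathfrak{d}}$ $$H\circ T=G+Z+\mathcal{P},\qquad \{G,Z\}=0,\qquad N^{\nabla}_{\mathfrak{d}}(\mathcal{P})\le\mu\exp\left(-\frac1\mu\right).$$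 Moreover, for every real initial datum $z_0\in B_{R,3\mathfrak{d}}$ the Hamilton equations $\dot z=X_H(z)$, $z(0)=z_0$, have a solution on $|t|\le\exp(1/\mu)$, and every such solution satisfies, for all $|t|\le \exp(1/\mu)$, $z(t)\in B_{R,\mathfrak{d}}$ and $$|G(z(t))-G(z_0)|<C\mu N_0(G),\qquad |Z(z(t))-Z(z_0)|<C\mu N_0(F).$$ -/

import Mathlib

open Set

noncomputable section

namespace KleinGordon

/-- Complex `ℓ²(ℤ^d)`. -/
abbrev Seq (d : ℕ) : Type := lp (fun _ : Fin d → ℤ => ℂ) 2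

/-- The complexified phase space `ℓ²(ℤ^d; ℂ) × ℓ²(ℤ^d; ℂ)` of points `z = (u, v)`,
with the Hilbert norm `‖z‖² = ∑ |u_j|² + |v_j|²`. -/
abbrev Phase (d : ℕ) : Type := WithLp 2 (Seq d × Seq d)

variable {d : ℕ}

/-- The position coordinate `u_j`. -/
def posCoord (z : Phase d) (j : Fin d → ℤ) : ℂ := z.fst j

/-- The momentum coordinate `v_j`. -/
def momCoord (z : Phase d) (j : Fin d → ℤ) : ℂ := z.snd j

/-- Points of the real phase space. -/
def IsReal (z : Phase d) : Prop := ∀ j, (posCoord z j).im = 0 ∧ (momCoord z j).im = 0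

/-- The ball `B_{R,δ}`: `‖z‖ < R (1 - δ)`. -/
def ballRd (d : ℕ) (R δ : ℝ) : Set (Phase d) := Metric.ball 0 (R * (1 - δ))

/-- The `i`-th lattice unit vector. -/
def unitVec (i : Fin d) : Fin d → ℤ := Pi.single i 1

/-- `G = ½ ∑_j (u_j² + v_j²)`. -/
def G (z : Phase d) : ℂ := 1 / 2 * ∑' j, (posCoord z j ^ 2 + momCoord z j ^ 2)

/-- `F = ε/(2p+2) ∑_j u_j^{2p+2} + ε/2 ∑_j ∑_{|j-h|=1} (u_j - u_h)²`; the `2d` neighbours `h`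
of `j` are the points `j ± e_i`. -/
def F (p : ℕ) (ε : ℝ) (z : Phase d) : ℂ :=
  (ε : ℂ) / (2 * (p : ℂ) + 2) * ∑' j, posCoord z j ^ (2 * p + 2) +
    (ε : ℂ) / 2 * ∑' j, ∑ i : Fin d,
      ((posCoord z j - posCoord z (j + unitVec i)) ^ 2 +
        (posCoord z j - posCoord z (j - unitVec i)) ^ 2)

/-- The scaled discrete Klein-Gordon Hamiltonian `H = G + F`. -/
def H (p : ℕ) (ε : ℝ) (z : Phase d) : ℂ := G z + F p ε z

/-- The Hamiltonian vector field `X_f = (∂f/∂v, -∂f/∂u)` of a holomorphic function `f`.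
The Riesz vector `w` of the differential satisfies `df(h) = ∑ conj(w_j) h_j`, so the vector of
partial derivatives of `f` is the complex conjugate of `w`. -/
def hamField (f : Phase d → ℂ) (z : Phase d) : Phase d :=
  let w : Phase d := (InnerProductSpace.toDual ℂ (Phase d)).symm (fderiv ℂ f z)
  WithLp.toLp 2 (star w.snd, -star w.fst)

/-- The Poisson bracket `{f, g} = ∑_j (∂f/∂u_j ∂g/∂v_j - ∂f/∂v_j ∂g/∂u_j) = df(X_g)`. -/
def poisson (f g : Phase d → ℂ) (z : Phase d) : ℂ := fderiv ℂ f z (hamField g z)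

/-- The (complex bilinear) symplectic form `∑_j (u_j v'_j - v_j u'_j)`. -/
def sympl (z w : Phase d) : ℂ :=
  ∑' j, (posCoord z j * momCoord w j - momCoord z j * posCoord w j)

/-- `T` is a canonical change of coordinates on the open set `U`: a biholomorphic map of `U` onto
an open set, preserving the symplectic form and mapping real points to real points. -/
structure IsCanonical (T : Phase d → Phase d) (U : Set (Phase d)) : Prop where
  holo : DifferentiableOn ℂ T U
  isOpen_image : IsOpen (T '' U)
  inverse : ∃ S : Phase d → Phase d, DifferentiableOn ℂ S (T '' U) ∧ LeftInvOn S T U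
  symplectic : ∀ z ∈ U, ∀ h k : Phase d, sympl (fderiv ℂ T z h) (fderiv ℂ T z k) = sympl h k
  real : ∀ z ∈ U, IsReal z → IsReal (T z)

/-- `N_δ(g) = sup_{B_{R,δ}} |g|`. -/
def supNorm (R δ : ℝ) (g : Phase d → ℂ) : ENNReal := ⨆ z ∈ ballRd d R δ, ‖g z‖ₑ

/-- `N^∇_δ(g) = R⁻¹ sup_{B_{R,δ}} ‖X_g‖`. -/
def fieldNorm (R δ : ℝ) (g : Phase d → ℂ) : ENNReal :=
  (ENNReal.ofReal R)⁻¹ * ⨆ z ∈ ballRd d R δ, ‖hamField g z‖ₑ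

/-- `z` solves Hamilton's equations `ż = X_f(z)` on the time interval `[-τ, τ]`, with
`z(0) = z₀`. -/
def IsOrbit (f : Phase d → ℂ) (τ : ℝ) (z₀ : Phase d) (z : ℝ → Phase d) : Prop :=
  z 0 = z₀ ∧ ∀ t ∈ Icc (-τ) τ, HasDerivWithinAt z (hamField f (z t)) (Icc (-τ) τ) t

/-- The small parameter `μ = 12 e π ω₁ / δ`, where `ω₁ = 2 ε (c + R^{2p})`. -/
def mu (c R δ : ℝ) (p : ℕ) (ε : ℝ) : ℝ :=
  12 * Real.exp 1 * Real.pi * (2 * ε * (c + R ^ (2 * p))) / δ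

end KleinGordon

end

/-!
The oscillator flow `exp (t A)` is isometric and `2π`-periodic. Averaging a perturbation `P` over
it gives its resonant part `⟨P⟩`, which commutes with the energy, and a Hamiltonian `χ`, bounded by
`P` without small divisors, with `dχ (A z) = P z - ⟨P⟩ z`. Instead of the time-one flow of `χ`, the
change of coordinates is an implicit midpoint step `z ↦ z + W (m z)`, `m z = z + W (m z) / 2`, of
the field `W` of `χ`: it is exactly symplectic, and since the energy is quadratic it changes by
exactly `-dχ (A (m z))`, so no Lie series has to be estimated. One step on a smaller ball divides
the size of the remainder by four, at the price of a radius proportional to the size of the first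
perturbation. A loss of radius `δ R` therefore leaves room for about `1 / μ` steps, which make the
remainder exponentially small. In the new coordinates the energy of a real orbit drifts slowly; as
the energy is half the squared norm at real points, a bootstrap confines the orbit to the ball.
-/

noncomputable section

namespace HolomorphicNormalForm

open Metric Filter Topology ComplexConjugate

/-! ### Bounded holomorphic functions on balls -/

theorem exists_ball_norm_le {E F : Type*} [PseudoMetricSpace E] [SeminormedAddCommGroup F]
    {f : E → F} {U : Set E} (hU : IsOpen U)
    (hf : ContinuousOn f U) {c : E} (hc : c ∈ U) :
    ∃ r > 0, ball c r ⊆ U ∧ ∃ M, ∀ z ∈ ball c r, ‖f z‖ ≤ M := by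
  have hbdd : ∀ᶠ z in 𝓝 c, ‖f z‖ < ‖f c‖ + 1 :=
    (hf.continuousAt (hU.mem_nhds hc)).norm.eventually_lt_const (lt_add_one _)
  obtain ⟨r, hr, h⟩ := Metric.eventually_nhds_iff_ball.1 (hbdd.and (hU.mem_nhds hc))
  exact ⟨r, hr, fun z hz => (h z hz).2, _, fun z hz => (h z hz).1.le⟩

section Banach

variable {E F : Type*} [NormedAddCommGroup E] [NormedSpace ℂ E] [NormedAddCommGroup F]
  [NormedSpace ℂ F]

theorem norm_fderiv_center_le {f : E → F} {c : E} {r M : ℝ} (hr : 0 < r)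
    (hf : DifferentiableOn ℂ f (ball c r)) (hM : ∀ z ∈ ball c r, ‖f z‖ ≤ M) :
    ‖fderiv ℂ f c‖ ≤ 2 * M / r := by
  refine Complex.norm_fderiv_le_div_of_mapsTo_ball hf (fun z hz => ?_) hr
  rw [mem_closedBall_iff_norm]
  linarith [norm_sub_le (f z) (f c), hM z hz, hM c (mem_ball_self hr)]

theorem norm_fderiv_le {f : E → F} {c z : E} {r s M : ℝ} (hs : 0 < s)
    (hf : DifferentiableOn ℂ f (ball c r)) (hM : ∀ z ∈ ball c r, ‖f z‖ ≤ M)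
    (hz : z ∈ ball c (r - s)) : ‖fderiv ℂ f z‖ ≤ 2 * M / s := by
  have hsub : ball z s ⊆ ball c r := ball_subset_ball' (by rw [mem_ball] at hz; linarith)
  exact norm_fderiv_center_le hs (hf.mono hsub) fun w hw => hM w (hsub hw)

theorem norm_sub_sub_fderiv_le {f : E → F} {c z : E} {r M : ℝ}
    (hf : DifferentiableOn ℂ f (ball c r)) (hM : ∀ z ∈ ball c r, ‖f z‖ ≤ M)
    (hz : z ∈ ball c r) :
    ‖f z - f c - fderiv ℂ f c (z - c)‖ ≤ 4 * M * (‖z - c‖ / r) ^ 2 := by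
  have hr : 0 < r := nonempty_ball.1 ⟨z, hz⟩
  have hc : c ∈ ball c r := mem_ball_self hr
  have hfc : DifferentiableAt ℂ f c := hf.differentiableAt (isOpen_ball.mem_nhds hc)
  have hlin : ∀ w ∈ ball c r, ‖fderiv ℂ f c (w - c)‖ ≤ 2 * M := fun w hw => by
    have hwr : ‖w - c‖ ≤ r := (mem_ball_iff_norm.1 hw).le
    have hd := norm_fderiv_center_le hr hf hM
    calc ‖fderiv ℂ f c (w - c)‖ ≤ 2 * M / r * ‖w - c‖ := (fderiv ℂ f c).le_of_opNorm_le hd _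
      _ ≤ 2 * M / r * r := mul_le_mul_of_nonneg_left hwr ((norm_nonneg _).trans hd)
      _ = 2 * M := div_mul_cancel₀ _ hr.ne'
  -- Schwarz's lemma of order two, for the remainder of the first order Taylor expansion
  have schwarz := Complex.dist_le_mul_div_pow_of_mapsTo_ball_of_isLittleO
    (f := fun w => f w - fderiv ℂ f c (w - c)) (R₁ := r) (R₂ := 4 * M) (n := 1)
    (hf.sub (by fun_prop)) (fun w hw => ?_) ?_ hz
  · simpa only [sub_self, map_zero, sub_zero, dist_eq_norm, sub_right_comm] using schwarz
  · rw [mem_closedBall_iff_norm]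
    simp only [sub_self, map_zero, sub_zero]
    linarith [hM w hw, hM c hc, hlin w hw, norm_sub_le (f w) (fderiv ℂ f c (w - c)),
      norm_sub_le (f w - fderiv ℂ f c (w - c)) (f c)]
  · simp only [sub_self, map_zero, sub_zero, pow_one]
    exact (hfc.hasFDerivAt.isLittleO.congr_left fun w => sub_right_comm _ _ _).norm_right

theorem uniformCauchySeqOn_fderiv {ι : Type*} {l : Filter ι} {f : ι → E → F} {c : E}
    {r s : ℝ} (hs : 0 < s) (hf : ∀ᶠ n in l, DifferentiableOn ℂ (f n) (ball c r))
    (hcauchy : UniformCauchySeqOn f l (ball c r)) :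
    UniformCauchySeqOn (fun n => fderiv ℂ (f n)) l (ball c (r - s)) := by
  intro u hu
  obtain ⟨ε, hε, hu⟩ := Metric.mem_uniformity_dist.1 hu
  have hclose := hcauchy _ (Metric.dist_mem_uniformity (show 0 < ε * s / 4 by positivity))
  filter_upwards [hclose, hf.prod_mk hf] with ⟨m, n⟩ hmn hfmn z hz
  have hsub : ball c (r - s) ⊆ ball c r := ball_subset_ball (by linarith)
  have hd : ∀ g : E → F, DifferentiableOn ℂ g (ball c r) → DifferentiableAt ℂ g z :=
    fun g hg => hg.differentiableAt (isOpen_ball.mem_nhds (hsub hz))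
  refine hu ?_
  calc dist (fderiv ℂ (f m) z) (fderiv ℂ (f n) z) = ‖fderiv ℂ (f m - f n) z‖ := by
        rw [dist_eq_norm, fderiv_sub (hd _ hfmn.1) (hd _ hfmn.2)]
    _ ≤ 2 * (ε * s / 4) / s := norm_fderiv_le hs (hfmn.1.sub hfmn.2)
        (fun w hw => by simpa only [dist_eq_norm, Pi.sub_apply] using (hmn w hw).le) hz
    _ = ε / 2 := by field_simp; norm_num
    _ < ε := half_lt_self hε

theorem differentiableAt_of_tendstoUniformlyOn [CompleteSpace F] {ι : Type*} {l : Filter ι}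
    [l.NeBot] {f : ι → E → F} {g : E → F} {c : E} {r : ℝ} (hr : 0 < r)
    (hf : ∀ᶠ n in l, DifferentiableOn ℂ (f n) (ball c r))
    (hfg : TendstoUniformlyOn f g l (ball c r)) : DifferentiableAt ℂ g c := by
  have hhalf : 0 < r - r / 2 := by linarith
  have hnhds : ball c (r - r / 2) ∈ 𝓝 c := ball_mem_nhds c hhalf
  have hsub : ball c (r - r / 2) ⊆ ball c r := ball_subset_ball (by linarith)
  have hcauchy := uniformCauchySeqOn_fderiv (half_pos hr) hf hfg.uniformCauchySeqOn
  have hlim : ∀ z ∈ ball c (r - r / 2), ∃ L, Tendsto (fun n => fderiv ℂ (f n) z) l (𝓝 L) :=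
    fun z hz => CompleteSpace.complete (hcauchy.cauchy_map hz)
  choose! g' hg' using hlim
  have hunif := (hcauchy.tendstoUniformlyOn_of_tendsto hg').tendstoUniformlyOnFilter
  refine (hasFDerivAt_of_tendstoUniformlyOnFilter (f := f)
    (hunif.mono_right (le_principal_iff.2 hnhds)) ?_ ?_).differentiableAt
  · filter_upwards [hf.prod_mk hnhds] with ⟨n, z⟩ h
    exact (h.1.differentiableAt (isOpen_ball.mem_nhds (hsub h.2))).hasFDerivAt
  · filter_upwards [hnhds] with z hz using hfg.tendsto_at (hsub hz)

theorem tendstoUniformlyOn_differenceQuotient {f : E → F} {c : E} {r s M : ℝ} (hs : 0 < s)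
    (hf : DifferentiableOn ℂ f (ball c r)) (hM : ∀ z ∈ ball c r, ‖f z‖ ≤ M) (h : E) :
    TendstoUniformlyOn (fun (t : ℂ) w => t⁻¹ • (f (w + t • h) - f w))
      (fun w => fderiv ℂ f w h) (𝓝[≠] 0) (ball c (r - s)) := by
  rw [Metric.tendstoUniformlyOn_iff]
  intro ε hε
  have hsmall : ∀ᶠ t : ℂ in 𝓝[≠] 0, ‖t • h‖ < s := nhdsWithin_le_nhds <|
    (show ContinuousAt _ _ by fun_prop).eventually_lt_const (by simpa using hs)
  have herror : ∀ᶠ t : ℂ in 𝓝[≠] 0, 4 * M * (‖h‖ / s) ^ 2 * ‖t‖ < ε := nhdsWithin_le_nhds <|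
    (show ContinuousAt _ _ by fun_prop).eventually_lt_const (by simpa using hε)
  filter_upwards [hsmall, herror, self_mem_nhdsWithin] with t ht hlt ht0 w hw
  have ht0 : t ≠ 0 := ht0
  have hsub : ball w s ⊆ ball c r := ball_subset_ball' (by rw [mem_ball] at hw; linarith)
  have htaylor := norm_sub_sub_fderiv_le (hf.mono hsub) (fun z hz => hM z (hsub hz))
    (z := w + t • h) (by simpa [mem_ball_iff_norm] using ht)
  rw [add_sub_cancel_left, map_smul] at htaylor
  calc dist (fderiv ℂ f w h) (t⁻¹ • (f (w + t • h) - f w))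
      = ‖t‖⁻¹ * ‖f (w + t • h) - f w - t • fderiv ℂ f w h‖ := by
        rw [dist_comm, dist_eq_norm, ← norm_inv, ← norm_smul, smul_sub _ (f _ - f _),
          inv_smul_smul₀ ht0]
    _ ≤ ‖t‖⁻¹ * (4 * M * (‖t • h‖ / s) ^ 2) := by gcongr
    _ = 4 * M * (‖h‖ / s) ^ 2 * ‖t‖ := by
        have : ‖t‖ ≠ 0 := norm_ne_zero_iff.2 ht0
        rw [norm_smul]
        field_simp
    _ < ε := hlt

theorem differentiableOn_fderiv_apply [CompleteSpace F] {f : E → F} {U : Set E}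
    (hU : IsOpen U) (hf : DifferentiableOn ℂ f U) (h : E) :
    DifferentiableOn ℂ (fun w => fderiv ℂ f w h) U := by
  intro c hc
  obtain ⟨r, hr, hrU, M, hM⟩ := exists_ball_norm_le hU hf.continuousOn hc
  replace hf := hf.mono hrU
  have hsmall : ∀ᶠ t : ℂ in 𝓝[≠] 0, ‖t • h‖ < r / 2 := nhdsWithin_le_nhds <|
    (show ContinuousAt _ _ by fun_prop).eventually_lt_const (by simpa using half_pos hr)
  refine (differentiableAt_of_tendstoUniformlyOn (r := r - r / 2) (by linarith) ?_
    (tendstoUniformlyOn_differenceQuotient (half_pos hr) hf hM h)).differentiableWithinAt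
  filter_upwards [hsmall] with t ht
  refine DifferentiableOn.const_smul (DifferentiableOn.sub (hf.comp (by fun_prop) ?_) ?_) _
  · intro w hw
    rw [mem_ball_iff_norm] at hw ⊢
    rw [add_sub_right_comm]
    linarith [norm_add_le (w - c) (t • h)]
  · exact hf.mono (ball_subset_ball (by linarith))

/-- The second derivative of `f` at `c` as a bounded bilinear map, given by the derivatives of the
directional derivatives `z ↦ fderiv ℂ f z h`. -/
def secondDeriv (f : E → F) {c : E} {C : ℝ}
    (hd : ∀ h, DifferentiableAt ℂ (fun z => fderiv ℂ f z h) c)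
    (hC : ∀ h, ‖fderiv ℂ (fun z => fderiv ℂ f z h) c‖ ≤ C * ‖h‖) : E →L[ℂ] E →L[ℂ] F :=
  LinearMap.mkContinuous
    { toFun := fun h => fderiv ℂ (fun z => fderiv ℂ f z h) c
      map_add' := fun h h' => by simpa only [map_add] using fderiv_fun_add (hd h) (hd h')
      map_smul' := fun a h => by
        simpa only [map_smul, RingHom.id_apply] using fderiv_fun_const_smul (hd h) a } C hC

theorem differentiableOn_fderiv [CompleteSpace F] {f : E → F} {U : Set E} (hU : IsOpen U)
    (hf : DifferentiableOn ℂ f U) : DifferentiableOn ℂ (fderiv ℂ f) U := by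
  intro c hc
  obtain ⟨r, hr, hrU, M, hM⟩ := exists_ball_norm_le hU hf.continuousOn hc
  set s := r / 2 with hs
  have hs0 : 0 < s := half_pos hr
  have hsr : ball c s = ball c (r - s) := by rw [hs]; congr 1; ring
  have hsU : ball c s ⊆ U := (ball_subset_ball (by linarith)).trans hrU
  have hdir : ∀ h, DifferentiableOn ℂ (fun w => fderiv ℂ f w h) (ball c s) :=
    fun h => (differentiableOn_fderiv_apply hU hf h).mono hsU
  have hM0 : 0 ≤ M := (norm_nonneg _).trans (hM c (mem_ball_self hr))
  have hbound : ∀ h, ∀ z ∈ ball c s, ‖fderiv ℂ f z h‖ ≤ 2 * M / s * ‖h‖ := fun h z hz =>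
    (fderiv ℂ f z).le_of_opNorm_le (norm_fderiv_le hs0 (hf.mono hrU) hM (hsr ▸ hz)) h
  let L : E →L[ℂ] E →L[ℂ] F := secondDeriv f (C := 2 * (2 * M / s) / s)
    (fun h => (hdir h).differentiableAt (ball_mem_nhds c hs0))
    (fun h => (norm_fderiv_center_le hs0 (hdir h) (hbound h)).trans_eq (by ring))
  refine (HasFDerivAt.differentiableAt (f' := L.flip) ?_).differentiableWithinAt
  have hquad : (fun z => fderiv ℂ f z - fderiv ℂ f c - L.flip (z - c)) =O[𝓝 c]
      fun z => ‖z - c‖ ^ 2 := by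
    refine Asymptotics.IsBigO.of_bound (4 * (2 * M / s) / s ^ 2) ?_
    filter_upwards [ball_mem_nhds c hs0] with z hz
    rw [norm_pow, norm_norm]
    refine ContinuousLinearMap.opNorm_le_bound _ (by positivity) fun h => ?_
    exact (norm_sub_sub_fderiv_le (hdir h) (hbound h) hz).trans_eq (by ring)
  refine HasFDerivAt.of_isLittleO (hquad.trans_isLittleO ?_)
  simpa [Function.comp_def] using (Asymptotics.isLittleO_norm_pow_id (E' := E)
    one_lt_two).comp_tendsto (tendsto_sub_nhds_zero_iff.2 (tendsto_id (x := 𝓝 c)))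

end Banach

theorem hasFDerivAt_bilinear_self {E : Type*} [NormedAddCommGroup E] [NormedSpace ℂ E]
    {B : E →L[ℂ] E →L[ℂ] ℂ} (hB : ∀ x y, B x y = B y x) (x : E) :
    HasFDerivAt (fun x => B x x) ((2 : ℂ) • B x) x := by
  refine (B.hasFDerivAt.clm_apply (hasFDerivAt_id x)).congr_fderiv ?_
  ext h
  simp [hB h x, two_mul]

/-! ### Near-identity maps -/

section NearIdentity

variable {E : Type*} [NormedAddCommGroup E] [NormedSpace ℂ E]

theorem approximatesLinearOn_id_add {W : E → E} {U : Set E} {q : NNReal} (hU : IsOpen U)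
    (hconv : Convex ℝ U) (hW : DifferentiableOn ℂ W U) (hq : ∀ z ∈ U, ‖fderiv ℂ W z‖ ≤ q) :
    ApproximatesLinearOn (fun x => x + W x) (ContinuousLinearEquiv.refl ℂ E : E →L[ℂ] E) U q := by
  intro x hx y hy
  have hlip := hconv.norm_image_sub_le_of_norm_fderiv_le
    (fun z hz => hW.differentiableAt (hU.mem_nhds hz)) hq hy hx
  convert hlip using 2
  simp only [ContinuousLinearEquiv.coe_refl, ContinuousLinearMap.id_apply]
  abel

theorem differentiableAt_symm_id_add [CompleteSpace E] {W : E → E} (Ψ : OpenPartialHomeomorph E E)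
    (hΨ : ∀ x, Ψ x = x + W x) {y : E} (hy : y ∈ Ψ.target)
    (hW : DifferentiableAt ℂ W (Ψ.symm y)) (hlt : ‖fderiv ℂ W (Ψ.symm y)‖ < 1) :
    DifferentiableAt ℂ Ψ.symm y := by
  let e : E ≃L[ℂ] E := ContinuousLinearEquiv.unitsEquiv ℂ E
    (Units.oneSub (-fderiv ℂ W (Ψ.symm y)) (by rwa [norm_neg]))
  have he : (e : E →L[ℂ] E) = ContinuousLinearMap.id ℂ E + fderiv ℂ W (Ψ.symm y) := by
    ext v
    simp [e, Units.oneSub]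
  refine (Ψ.hasFDerivAt_symm (f' := e) hy ?_).differentiableAt
  rw [he, show (Ψ : E → E) = fun x => x + W x from funext hΨ]
  exact (hasFDerivAt_id _).add hW.hasFDerivAt

theorem exists_openPartialHomeomorph_id_add [CompleteSpace E] [Nontrivial E] {W : E → E}
    {ρ σ w : ℝ} (hσ : 0 < σ) (hW : DifferentiableOn ℂ W (ball 0 ρ))
    (hw : ∀ z ∈ ball 0 ρ, ‖W z‖ ≤ w) (hwσ : 8 * w ≤ σ) :
    ∃ Ψ : OpenPartialHomeomorph E E, Ψ.source = ball 0 (ρ - σ / 2) ∧ (∀ x, Ψ x = x + W x) ∧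
      ball 0 (ρ - σ) ⊆ Ψ.target ∧ DifferentiableOn ℂ Ψ.symm Ψ.target := by
  have hsub : ball (0 : E) (ρ - σ / 2) ⊆ ball 0 ρ := ball_subset_ball (by linarith)
  have hderiv : ∀ z ∈ ball (0 : E) (ρ - σ / 2), ‖fderiv ℂ W z‖ ≤ (1 / 2 : NNReal) :=
    fun z hz => (norm_fderiv_le (half_pos hσ) hW hw hz).trans <| by
      rw [div_le_iff₀ (half_pos hσ)]
      push_cast
      linarith
  have happ := approximatesLinearOn_id_add isOpen_ball (convex_ball 0 _) (hW.mono hsub) hderiv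
  have hnorm : ‖((ContinuousLinearEquiv.refl ℂ E).symm : E →L[ℂ] E)‖₊ = 1 := by simp
  have hhalf : (1 / 2 : NNReal) < ‖((ContinuousLinearEquiv.refl ℂ E).symm : E →L[ℂ] E)‖₊⁻¹ := by
    rw [hnorm, inv_one]
    exact NNReal.half_lt_self one_ne_zero
  refine ⟨happ.toOpenPartialHomeomorph _ _ (Or.inr hhalf) isOpen_ball, rfl, fun _ => rfl,
    fun y hy => ?_, fun y hy => DifferentiableAt.differentiableWithinAt ?_⟩
  · have hcb : closedBall y (σ / 4) ⊆ ball 0 (ρ - σ / 2) :=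
      closedBall_subset_ball' (by rw [mem_ball] at hy; linarith)
    refine happ.closedBall_subset_target (Or.inr hhalf) isOpen_ball (by linarith) hcb ?_
    rw [mem_closedBall, dist_comm, dist_eq_norm, hnorm, add_sub_cancel_left]
    refine (hw y (hsub (hcb (mem_closedBall_self (by linarith))))).trans ?_
    norm_num
    linarith
  · set Ψ := happ.toOpenPartialHomeomorph _ _ (Or.inr hhalf) isOpen_ball
    have hx : Ψ.symm y ∈ ball (0 : E) (ρ - σ / 2) := Ψ.map_target hy
    exact differentiableAt_symm_id_add Ψ (fun _ => rfl) hy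
      (hW.differentiableAt (isOpen_ball.mem_nhds (hsub hx)))
      ((hderiv _ hx).trans_lt (by norm_num))

end NearIdentity

/-! ### Averaging along the oscillator flow -/

/-- A complex Banach space with a symplectic form `ω`, the map `J` sending a differential to its
Hamiltonian vector, a conjugation `c` and a harmonic-oscillator field `A`. The flow
`exp (t A) = cos t + sin t A` is isometric, and at real points the quadratic Hamiltonian
`ω (A x) x / 2` of the field `A` is half the squared norm. -/
structure OscillatorSpace (E : Type*) [NormedAddCommGroup E] [NormedSpace ℂ E] where
  ω : E →L[ℂ] E →L[ℂ] ℂ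
  J : (E →L[ℂ] ℂ) →L[ℂ] E
  A : E →L[ℂ] E
  c : E →L⋆[ℂ] E
  ω_antisymm : ∀ x y, ω x y = -ω y x
  ω_J : ∀ l x, ω (J l) x = l x
  norm_J : ∀ l, ‖J l‖ ≤ ‖l‖
  J_conj : ∀ l l' : E →L[ℂ] ℂ, (∀ x, l' x = conj (l (c x))) → J l' = c (J l)
  ω_c : ∀ x y, ω (c x) (c y) = conj (ω x y)
  A_A : ∀ x, A (A x) = -x
  ω_A : ∀ x y, ω (A x) y = ω (A y) x
  norm_rot : ∀ (t : ℝ) (x : E), ‖(Real.cos t : ℂ) • x + (Real.sin t : ℂ) • A x‖ = ‖x‖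
  c_c : ∀ x, c (c x) = x
  norm_c : ∀ x, ‖c x‖ = ‖x‖
  A_c : ∀ x, A (c x) = c (A x)
  ω_A_self : ∀ x, c x = x → ω (A x) x = ((‖x‖ ^ 2 : ℝ) : ℂ)

namespace OscillatorSpace

variable {E : Type*} [NormedAddCommGroup E] [NormedSpace ℂ E] (S : OscillatorSpace E)

/-- Hamiltonian functions on the ball of radius `ρ`: holomorphic, with differential bounded by
`M`, and intertwining the conjugations, so that they are real at the real points. -/
structure IsHamiltonian (ρ M : ℝ) (f : E → ℂ) : Prop where
  holo : DifferentiableOn ℂ f (ball 0 ρ)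
  bound : ∀ z ∈ ball 0 ρ, ‖fderiv ℂ f z‖ ≤ M
  real : ∀ z ∈ ball 0 ρ, f (S.c z) = conj (f z)

variable {S}

theorem c_mem_ball {ρ : ℝ} {z : E} (hz : z ∈ ball 0 ρ) : S.c z ∈ ball 0 ρ := by
  simpa only [mem_ball_zero_iff, S.norm_c] using hz

namespace IsHamiltonian

variable {ρ M : ℝ} {f : E → ℂ}

theorem differentiableAt (hf : S.IsHamiltonian ρ M f) {z : E} (hz : z ∈ ball 0 ρ) :
    DifferentiableAt ℂ f z := hf.holo.differentiableAt (isOpen_ball.mem_nhds hz)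

theorem bound_nonneg (hf : S.IsHamiltonian ρ M f) {z : E} (hz : z ∈ ball 0 ρ) : 0 ≤ M :=
  (norm_nonneg _).trans (hf.bound z hz)

theorem mono (hf : S.IsHamiltonian ρ M f) {ρ' M' : ℝ} (hρ : ρ' ≤ ρ) (hM : M ≤ M') :
    S.IsHamiltonian ρ' M' f where
  holo := hf.holo.mono (ball_subset_ball hρ)
  bound z hz := (hf.bound z (ball_subset_ball hρ hz)).trans hM
  real z hz := hf.real z (ball_subset_ball hρ hz)

theorem add (hf : S.IsHamiltonian ρ M f) {M' : ℝ} {g : E → ℂ} (hg : S.IsHamiltonian ρ M' g) :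
    S.IsHamiltonian ρ (M + M') (fun z => f z + g z) where
  holo := hf.holo.add hg.holo
  bound z hz := by
    rw [fderiv_fun_add (hf.differentiableAt hz) (hg.differentiableAt hz)]
    exact norm_add_le_of_le (hf.bound z hz) (hg.bound z hz)
  real z hz := by rw [hf.real z hz, hg.real z hz, map_add]

theorem norm_sub_le (hf : S.IsHamiltonian ρ M f) {x y : E} (hx : x ∈ ball 0 ρ)
    (hy : y ∈ ball 0 ρ) : ‖f y - f x‖ ≤ M * ‖y - x‖ :=
  (convex_ball (0 : E) ρ).norm_image_sub_le_of_norm_fderiv_le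
    (fun _ hz => hf.differentiableAt hz) hf.bound hx hy

theorem norm_le (hf : S.IsHamiltonian ρ M f) {z : E} (hz : z ∈ ball 0 ρ) :
    ‖f z‖ ≤ ‖f 0‖ + M * ρ := by
  have h0 : (0 : E) ∈ ball 0 ρ := mem_ball_self (nonempty_ball.1 ⟨z, hz⟩)
  calc ‖f z‖ ≤ ‖f 0‖ + ‖f z - f 0‖ := norm_le_norm_add_norm_sub' _ _
    _ ≤ ‖f 0‖ + M * ‖z - 0‖ := by gcongr; exact hf.norm_sub_le h0 hz
    _ ≤ ‖f 0‖ + M * ρ := by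
      have hM := hf.bound_nonneg hz
      rw [sub_zero]
      gcongr
      exact (mem_ball_zero_iff.1 hz).le

theorem fderiv_conj (hf : S.IsHamiltonian ρ M f) {z : E} (hz : z ∈ ball 0 ρ) (h : E) :
    fderiv ℂ f (S.c z) h = conj (fderiv ℂ f z (S.c h)) := by
  have hline : HasDerivAt (fun t : ℂ => f (S.c z + t • h)) (fderiv ℂ f (S.c z) h) 0 :=
    (hf.differentiableAt (c_mem_ball hz)).hasFDerivAt.hasLineDerivAt h
  have hline_conj := HasDerivAt.conj_conj (x := 0)
    ((hf.differentiableAt hz).hasFDerivAt.hasLineDerivAt (S.c h))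
  rw [map_zero] at hline_conj
  have hcont : ContinuousAt (fun t : ℂ => z + conj t • S.c h) 0 :=
    (continuous_const.add (Complex.continuous_conj.smul continuous_const)).continuousAt
  have hmem : ∀ᶠ t in 𝓝 (0 : ℂ), z + conj t • S.c h ∈ ball (0 : E) ρ :=
    hcont.eventually_mem (by simpa using isOpen_ball.mem_nhds hz)
  refine hline.unique (hline_conj.congr_of_eventuallyEq ?_)
  filter_upwards [hmem] with t ht
  rw [Function.comp_apply, Function.comp_apply, ← hf.real _ ht, map_add, map_smulₛₗ,
    S.c_c, Complex.conj_conj]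

theorem differentiableOn_field (hf : S.IsHamiltonian ρ M f) :
    DifferentiableOn ℂ (fun z => S.J (fderiv ℂ f z)) (ball 0 ρ) :=
  S.J.differentiable.comp_differentiableOn (differentiableOn_fderiv isOpen_ball hf.holo)

theorem norm_field_le (hf : S.IsHamiltonian ρ M f) {z : E} (hz : z ∈ ball 0 ρ) :
    ‖S.J (fderiv ℂ f z)‖ ≤ M := (S.norm_J _).trans (hf.bound z hz)

theorem field_conj (hf : S.IsHamiltonian ρ M f) {z : E} (hz : z ∈ ball 0 ρ) :
    S.J (fderiv ℂ f (S.c z)) = S.c (S.J (fderiv ℂ f z)) :=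
  S.J_conj _ _ (hf.fderiv_conj hz)

theorem ω_fderiv_field (hf : S.IsHamiltonian ρ M f) {z : E} (hz : z ∈ ball 0 ρ) (h k : E) :
    S.ω (fderiv ℂ (fun z => S.J (fderiv ℂ f z)) z h) k
      + S.ω h (fderiv ℂ (fun z => S.J (fderiv ℂ f z)) z k) = 0 := by
  have hd : DifferentiableAt ℂ (fderiv ℂ f) z :=
    (differentiableOn_fderiv isOpen_ball hf.holo).differentiableAt (isOpen_ball.mem_nhds hz)
  have hfield : fderiv ℂ (fun z => S.J (fderiv ℂ f z)) z = S.J.comp (fderiv ℂ (fderiv ℂ f) z) :=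
    (S.J.hasFDerivAt.comp z hd.hasFDerivAt).fderiv
  have hnear : ∀ᶠ y in 𝓝 z, HasFDerivAt f (fderiv ℂ f y) y := by
    filter_upwards [isOpen_ball.mem_nhds hz] with y hy using (hf.differentiableAt hy).hasFDerivAt
  have hsymm := second_derivative_symmetric_of_eventually hnear hd.hasFDerivAt h k
  rw [hfield, S.ω_antisymm h, ContinuousLinearMap.comp_apply, ContinuousLinearMap.comp_apply,
    S.ω_J, S.ω_J, hsymm, add_neg_cancel]

end IsHamiltonian

variable (S)

/-- The time `t` flow `exp (t A)` of the harmonic oscillators. -/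
def rot (t : ℝ) : E →L[ℂ] E :=
  (Real.cos t : ℂ) • ContinuousLinearMap.id ℂ E + (Real.sin t : ℂ) • S.A

theorem rot_apply (t : ℝ) (z : E) :
    S.rot t z = (Real.cos t : ℂ) • z + (Real.sin t : ℂ) • S.A z := rfl

theorem norm_rot_apply (t : ℝ) (z : E) : ‖S.rot t z‖ = ‖z‖ := S.norm_rot t z

theorem norm_rot_le (t : ℝ) : ‖S.rot t‖ ≤ 1 :=
  ContinuousLinearMap.opNorm_le_bound _ zero_le_one fun z => by
    rw [S.norm_rot_apply, one_mul]

theorem norm_A (z : E) : ‖S.A z‖ = ‖z‖ := by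
  simpa only [Real.cos_pi_div_two, Real.sin_pi_div_two, Complex.ofReal_zero, zero_smul, zero_add,
    Complex.ofReal_one, one_smul] using S.norm_rot (Real.pi / 2) z

theorem rot_mem_ball {ρ : ℝ} {z : E} (hz : z ∈ ball 0 ρ) (t : ℝ) : S.rot t z ∈ ball 0 ρ := by
  simpa only [mem_ball_zero_iff, S.norm_rot_apply] using hz

theorem rot_zero (z : E) : S.rot 0 z = z := by simp [rot_apply]

theorem rot_two_pi (z : E) : S.rot (2 * Real.pi) z = z := by
  rw [rot_apply, Real.cos_two_pi, Real.sin_two_pi]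
  simp

theorem rot_conj (t : ℝ) (z : E) : S.rot t (S.c z) = S.c (S.rot t z) := by
  simp only [rot_apply, map_add, map_smulₛₗ, Complex.conj_ofReal, S.A_c]

theorem continuous_rot : Continuous S.rot :=
  ((Complex.continuous_ofReal.comp Real.continuous_cos).smul continuous_const).add
    ((Complex.continuous_ofReal.comp Real.continuous_sin).smul continuous_const)

theorem hasDerivAt_rot (t : ℝ) (z : E) :
    HasDerivAt (fun s => S.rot s z) (S.rot t (S.A z)) t := by
  have h : HasDerivAt (fun s => S.rot s z) _ t :=
    ((Real.hasDerivAt_cos t).ofReal_comp.smul_const z).add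
      ((Real.hasDerivAt_sin t).ofReal_comp.smul_const (S.A z))
  refine h.congr_deriv ?_
  rw [rot_apply, S.A_A]
  push_cast
  module

/-- The average of `f` along the oscillator flow with weight `a`. -/
def avg (a : ℝ → ℝ) (f : E → ℂ) (z : E) : ℂ :=
  (2 * Real.pi : ℂ)⁻¹ * ∫ s in (0 : ℝ)..2 * Real.pi, (a s : ℂ) * f (S.rot s z)

/-- The derivative at `z` of the integrand of `avg`, at time `s`. -/
def avgDeriv (a : ℝ → ℝ) (f : E → ℂ) (z : E) (s : ℝ) : E →L[ℂ] ℂ :=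
  (a s : ℂ) • (fderiv ℂ f (S.rot s z)).comp (S.rot s)

variable {S}

namespace IsHamiltonian

variable {ρ M C : ℝ} {f : E → ℂ} {a : ℝ → ℝ} {z : E}

theorem continuous_comp_rot (hf : S.IsHamiltonian ρ M f) (hz : z ∈ ball 0 ρ) :
    Continuous fun s => f (S.rot s z) :=
  hf.holo.continuousOn.comp_continuous (S.continuous_rot.clm_apply continuous_const)
    fun s => S.rot_mem_ball hz s

theorem continuous_fderiv_comp_rot (hf : S.IsHamiltonian ρ M f) (hz : z ∈ ball 0 ρ) :
    Continuous fun s => fderiv ℂ f (S.rot s z) :=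
  (differentiableOn_fderiv isOpen_ball hf.holo).continuousOn.comp_continuous
    (S.continuous_rot.clm_apply continuous_const) fun s => S.rot_mem_ball hz s

theorem continuous_mul_comp_rot (hf : S.IsHamiltonian ρ M f) (ha : Continuous a)
    (hz : z ∈ ball 0 ρ) : Continuous fun s => (a s : ℂ) * f (S.rot s z) :=
  (Complex.continuous_ofReal.comp ha).mul (hf.continuous_comp_rot hz)

theorem continuous_avgDeriv (hf : S.IsHamiltonian ρ M f) (ha : Continuous a)
    (hz : z ∈ ball 0 ρ) : Continuous (S.avgDeriv a f z) :=
  (Complex.continuous_ofReal.comp ha).smul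
    ((hf.continuous_fderiv_comp_rot hz).clm_comp S.continuous_rot)

theorem norm_avgDeriv_le (hf : S.IsHamiltonian ρ M f) (hz : z ∈ ball 0 ρ) {s : ℝ}
    (hs : |a s| ≤ C) : ‖S.avgDeriv a f z s‖ ≤ C * M := by
  have hcomp : ‖(fderiv ℂ f (S.rot s z)).comp (S.rot s)‖ ≤ M * 1 :=
    (ContinuousLinearMap.opNorm_comp_le _ _).trans (mul_le_mul (hf.bound _ (S.rot_mem_ball hz s))
      (S.norm_rot_le s) (norm_nonneg _) (hf.bound_nonneg hz))
  rw [mul_one] at hcomp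
  rw [avgDeriv, norm_smul, Complex.norm_real]
  exact mul_le_mul hs hcomp (norm_nonneg _) ((abs_nonneg _).trans hs)

theorem hasFDerivAt_avg (hf : S.IsHamiltonian ρ M f) (ha : Continuous a)
    (haC : ∀ s ∈ uIoc 0 (2 * Real.pi), |a s| ≤ C) (hz : z ∈ ball 0 ρ) :
    HasFDerivAt (S.avg a f)
      ((2 * Real.pi : ℂ)⁻¹ • ∫ s in (0 : ℝ)..2 * Real.pi, S.avgDeriv a f z s) z := by
  refine (intervalIntegral.hasFDerivAt_integral_of_dominated_of_fderiv_le (𝕜 := ℂ)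
    (bound := fun _ => C * M) (F' := S.avgDeriv a f) (isOpen_ball.mem_nhds hz) ?_
    ((hf.continuous_mul_comp_rot ha hz).intervalIntegrable _ _)
    (hf.continuous_avgDeriv ha hz).aestronglyMeasurable
    (Eventually.of_forall fun s hs w hw => hf.norm_avgDeriv_le hw (haC s hs))
    intervalIntegrable_const
    (Eventually.of_forall fun s _ w hw => ?_)).const_mul _
  · filter_upwards [isOpen_ball.mem_nhds hz] with w hw
    exact (hf.continuous_mul_comp_rot ha hw).aestronglyMeasurable
  · exact ((hf.differentiableAt (S.rot_mem_ball hw s)).hasFDerivAt.comp w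
      (S.rot s).hasFDerivAt).const_mul _

theorem norm_fderiv_avg_le (hf : S.IsHamiltonian ρ M f) (ha : Continuous a)
    (haC : ∀ s ∈ uIoc 0 (2 * Real.pi), |a s| ≤ C) (hz : z ∈ ball 0 ρ) :
    ‖fderiv ℂ (S.avg a f) z‖ ≤ C * M := by
  have hpi : 0 < 2 * Real.pi := Real.two_pi_pos
  have hint := intervalIntegral.norm_integral_le_of_norm_le_const (a := 0) (b := 2 * Real.pi)
    fun s hs => hf.norm_avgDeriv_le hz (haC s hs)
  have hnorm : ‖(2 * Real.pi : ℂ)⁻¹‖ = (2 * Real.pi)⁻¹ := by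
    rw [norm_inv, ← Complex.ofReal_ofNat, ← Complex.ofReal_mul, Complex.norm_of_nonneg hpi.le]
  rw [sub_zero, abs_of_pos hpi] at hint
  rwa [(hf.hasFDerivAt_avg ha haC hz).fderiv, norm_smul, hnorm, inv_mul_le_iff₀ hpi,
    mul_comm (2 * Real.pi)]

theorem avg_conj (hf : S.IsHamiltonian ρ M f) (ha : Continuous a) (hz : z ∈ ball 0 ρ) :
    S.avg a f (S.c z) = conj (S.avg a f z) := by
  have hint : conj (∫ s in (0 : ℝ)..2 * Real.pi, (a s : ℂ) * f (S.rot s z))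
      = ∫ s in (0 : ℝ)..2 * Real.pi, conj ((a s : ℂ) * f (S.rot s z)) :=
    (Complex.conjCLE.toContinuousLinearMap.intervalIntegral_comp_comm
      ((hf.continuous_mul_comp_rot ha hz).intervalIntegrable _ _)).symm
  rw [OscillatorSpace.avg, OscillatorSpace.avg, map_mul, hint, map_inv₀, map_mul, map_ofNat,
    Complex.conj_ofReal]
  congr 1
  refine intervalIntegral.integral_congr fun s _ => ?_
  simp only [map_mul, Complex.conj_ofReal]
  rw [S.rot_conj, hf.real _ (S.rot_mem_ball hz s)]

theorem avg (hf : S.IsHamiltonian ρ M f) (ha : Continuous a)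
    (haC : ∀ s ∈ uIoc 0 (2 * Real.pi), |a s| ≤ C) : S.IsHamiltonian ρ (C * M) (S.avg a f) where
  holo _ hz := (hf.hasFDerivAt_avg ha haC hz).differentiableAt.differentiableWithinAt
  bound _ hz := hf.norm_fderiv_avg_le ha haC hz
  real _ hz := hf.avg_conj ha hz

theorem hasDerivAt_comp_rot (hf : S.IsHamiltonian ρ M f) (hz : z ∈ ball 0 ρ) (s : ℝ) :
    HasDerivAt (fun s => f (S.rot s z)) (fderiv ℂ f (S.rot s z) (S.rot s (S.A z))) s := by
  have hf' := (hf.differentiableAt (S.rot_mem_ball hz s)).hasFDerivAt.restrictScalars ℝ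
  exact hf'.comp_hasDerivAt s (S.hasDerivAt_rot s z)

theorem fderiv_avg_A (hf : S.IsHamiltonian ρ M f) {a' : ℝ → ℝ} (ha' : Continuous a')
    (haa' : ∀ s, HasDerivAt a (a' s) s) (haC : ∀ s ∈ uIoc 0 (2 * Real.pi), |a s| ≤ C)
    (hz : z ∈ ball 0 ρ) :
    fderiv ℂ (S.avg a f) z (S.A z)
      = (2 * Real.pi : ℂ)⁻¹ * ((a (2 * Real.pi) - a 0 : ℝ) : ℂ) * f z - S.avg a' f z := by
  have ha : Continuous a := continuous_iff_continuousAt.2 fun s => (haa' s).continuousAt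
  have hcont : Continuous fun s => fderiv ℂ f (S.rot s z) (S.rot s (S.A z)) :=
    (hf.continuous_fderiv_comp_rot hz).clm_apply (S.continuous_rot.clm_apply continuous_const)
  have hparts := intervalIntegral.integral_mul_deriv_eq_deriv_mul (a := 0) (b := 2 * Real.pi)
    (fun s _ => (haa' s).ofReal_comp) (fun s _ => hf.hasDerivAt_comp_rot hz s)
    ((Complex.continuous_ofReal.comp ha').intervalIntegrable _ _) (hcont.intervalIntegrable _ _)
  rw [(hf.hasFDerivAt_avg ha haC hz).fderiv, smul_apply,
    ContinuousLinearMap.intervalIntegral_apply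
      ((hf.continuous_avgDeriv ha hz).intervalIntegrable _ _)]
  simp only [avgDeriv, smul_apply, ContinuousLinearMap.comp_apply, smul_eq_mul]
  rw [hparts, S.rot_zero, S.rot_two_pi, OscillatorSpace.avg]
  push_cast
  ring

end IsHamiltonian

variable (S)

/-- The average of `f` over the oscillator flow. -/
def mean (f : E → ℂ) : E → ℂ := S.avg (fun _ => 1) f

/-- The solution `χ` of the homological equation `dχ(A z) = f z - mean f z`. -/
def generator (f : E → ℂ) : E → ℂ := S.avg (fun s => s - Real.pi) f

variable {S}

theorem abs_sub_pi_le {s : ℝ} (hs : s ∈ uIoc 0 (2 * Real.pi)) : |s - Real.pi| ≤ 4 := by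
  rw [uIoc_of_le Real.two_pi_pos.le] at hs
  rw [abs_le]
  constructor <;> linarith [hs.1, hs.2, Real.pi_le_four]

namespace IsHamiltonian

variable {ρ M : ℝ} {f : E → ℂ}

theorem mean (hf : S.IsHamiltonian ρ M f) : S.IsHamiltonian ρ M (S.mean f) := by
  simpa only [one_mul, OscillatorSpace.mean] using
    hf.avg continuous_const (C := 1) fun _ _ => by rw [abs_one]

theorem generator (hf : S.IsHamiltonian ρ M f) : S.IsHamiltonian ρ (4 * M) (S.generator f) :=
  hf.avg (continuous_id.sub continuous_const) fun _ => abs_sub_pi_le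

theorem fderiv_mean_A (hf : S.IsHamiltonian ρ M f) {z : E} (hz : z ∈ ball 0 ρ) :
    fderiv ℂ (S.mean f) z (S.A z) = 0 := by
  rw [OscillatorSpace.mean, hf.fderiv_avg_A (a' := fun _ => 0) continuous_const
    (fun s => hasDerivAt_const s (1 : ℝ)) (C := 1) (fun _ _ => by rw [abs_one]) hz]
  simp [OscillatorSpace.avg]

theorem fderiv_generator_A (hf : S.IsHamiltonian ρ M f) {z : E} (hz : z ∈ ball 0 ρ) :
    fderiv ℂ (S.generator f) z (S.A z) = f z - S.mean f z := by
  have hpi : (Real.pi : ℂ) ≠ 0 := Complex.ofReal_ne_zero.2 Real.pi_ne_zero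
  rw [OscillatorSpace.generator, hf.fderiv_avg_A (a' := fun _ => 1) continuous_const
    (fun s => (hasDerivAt_id' s).sub_const Real.pi) (fun _ => abs_sub_pi_le) hz,
    OscillatorSpace.mean]
  push_cast
  field_simp
  ring

end IsHamiltonian

end OscillatorSpace

/-! ### The implicit midpoint step -/

namespace OscillatorSpace

variable {E : Type*} [NormedAddCommGroup E] [NormedSpace ℂ E] (S : OscillatorSpace E)

/-- Holomorphic maps from the ball of radius `r` to the ball of radius `ρ` which commute with the
conjugation, and so map real points to real points. -/
structure IsRealMap (r ρ : ℝ) (T : E → E) : Prop where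
  holo : DifferentiableOn ℂ T (ball 0 r)
  mapsTo : MapsTo T (ball 0 r) (ball 0 ρ)
  real : ∀ z ∈ ball 0 r, T (S.c z) = S.c (T z)

/-- Real maps between balls which preserve the symplectic form. -/
structure IsSymplecticMap (r ρ : ℝ) (T : E → E) : Prop extends S.IsRealMap r ρ T where
  sympl : ∀ z ∈ ball 0 r, ∀ h k, S.ω (fderiv ℂ T z h) (fderiv ℂ T z k) = S.ω h k

variable {S}

theorem isRealMap_id {r ρ : ℝ} (hr : r ≤ ρ) : S.IsRealMap r ρ fun z => z where
  holo := differentiableOn_id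
  mapsTo _ hz := ball_subset_ball hr hz
  real _ _ := rfl

namespace IsRealMap

variable {r ρ : ℝ} {T : E → E}

theorem differentiableAt (hT : S.IsRealMap r ρ T) {z : E} (hz : z ∈ ball 0 r) :
    DifferentiableAt ℂ T z := hT.holo.differentiableAt (isOpen_ball.mem_nhds hz)

theorem comp (hT : S.IsRealMap r ρ T) {r' : ℝ} {T' : E → E} (hT' : S.IsRealMap r' r T') :
    S.IsRealMap r' ρ (T ∘ T') where
  holo := hT.holo.comp hT'.holo hT'.mapsTo
  mapsTo := hT.mapsTo.comp hT'.mapsTo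
  real z hz := by
    rw [Function.comp_apply, Function.comp_apply, hT'.real z hz, hT.real _ (hT'.mapsTo hz)]

end IsRealMap

theorem isSymplecticMap_id {r ρ : ℝ} (hr : r ≤ ρ) : S.IsSymplecticMap r ρ fun z => z where
  toIsRealMap := isRealMap_id hr
  sympl _ _ h k := by rw [fderiv_fun_id, ContinuousLinearMap.id_apply, ContinuousLinearMap.id_apply]

theorem IsSymplecticMap.comp {r ρ r' : ℝ} {T T' : E → E} (hT : S.IsSymplecticMap r ρ T)
    (hT' : S.IsSymplecticMap r' r T') : S.IsSymplecticMap r' ρ (T ∘ T') where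
  toIsRealMap := hT.toIsRealMap.comp hT'.toIsRealMap
  sympl z hz h k := by
    rw [fderiv_comp z (hT.differentiableAt (hT'.mapsTo hz)) (hT'.differentiableAt hz),
      ContinuousLinearMap.comp_apply, ContinuousLinearMap.comp_apply, hT.sympl _ (hT'.mapsTo hz),
      hT'.sympl z hz]

theorem IsSymplecticMap.mono {r ρ r' : ℝ} {T : E → E} (hT : S.IsSymplecticMap r ρ T)
    (hr : r' ≤ r) : S.IsSymplecticMap r' ρ T :=
  hT.comp (isSymplecticMap_id hr)

theorem IsHamiltonian.sub_comp {f : E → ℂ} {T T' : E → E} {ρ M r s d : ℝ}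
    (hf : S.IsHamiltonian ρ M f) (hT : S.IsRealMap r ρ T) (hT' : S.IsRealMap r ρ T')
    (hM : 0 ≤ M) (hs : 0 < s) (hd : ∀ z ∈ ball 0 r, ‖T z - T' z‖ ≤ d) :
    S.IsHamiltonian (r - s) (2 * (M * d) / s) fun z => f (T z) - f (T' z) := by
  have hsub : ball (0 : E) (r - s) ⊆ ball 0 r := ball_subset_ball (by linarith)
  have hholo : DifferentiableOn ℂ (fun z => f (T z) - f (T' z)) (ball 0 r) :=
    (hf.holo.comp hT.holo hT.mapsTo).sub (hf.holo.comp hT'.holo hT'.mapsTo)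
  have hbound : ∀ z ∈ ball 0 r, ‖f (T z) - f (T' z)‖ ≤ M * d := fun z hz =>
    (hf.norm_sub_le (hT'.mapsTo hz) (hT.mapsTo hz)).trans (by gcongr; exact hd z hz)
  refine ⟨hholo.mono hsub, fun z hz => norm_fderiv_le hs hholo hbound hz, fun z hz => ?_⟩
  have hz := hsub hz
  rw [hT.real z hz, hT'.real z hz, hf.real _ (hT.mapsTo hz), hf.real _ (hT'.mapsTo hz), map_sub]

theorem symm_c (Ψ : OpenPartialHomeomorph E E) {r : ℝ} (hsource : Ψ.source = ball 0 r)
    (hreal : ∀ x ∈ ball 0 r, Ψ (S.c x) = S.c (Ψ x)) {y : E} (hy : y ∈ Ψ.target) :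
    Ψ.symm (S.c y) = S.c (Ψ.symm y) := by
  have hx : Ψ.symm y ∈ ball 0 r := hsource ▸ Ψ.map_target hy
  have hcx : S.c (Ψ.symm y) ∈ Ψ.source := hsource ▸ c_mem_ball hx
  rw [← Ψ.left_inv hcx, hreal _ hx, Ψ.right_inv hy]

variable (S)

/-- The energy of the harmonic oscillators. -/
def energy (z : E) : ℂ := S.ω (S.A z) z / 2

theorem energy_midpoint (m x : E) :
    S.energy (m + (1 / 2 : ℂ) • x) = S.energy (m - (1 / 2 : ℂ) • x) + S.ω (S.A m) x := by
  simp only [energy, map_add, map_sub, map_smul, add_apply, sub_apply, smul_apply, smul_eq_mul]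
  linear_combination (1 / 2 : ℂ) * S.ω_A x m

theorem ω_cayley {h k h' k' : E} (hskew : S.ω h' k + S.ω h k' = 0) :
    S.ω (h + (1 / 2 : ℂ) • h') (k + (1 / 2 : ℂ) • k')
      = S.ω (h - (1 / 2 : ℂ) • h') (k - (1 / 2 : ℂ) • k') := by
  simp only [map_add, map_sub, map_smul, add_apply, sub_apply, smul_apply, smul_eq_mul]
  linear_combination hskew

/-- `m z` is the midpoint of the implicit midpoint step with initial point `z` for the Hamiltonian
field of `χ`. The step itself is `midpointStep`. -/
structure IsMidpointMap (χ : E → ℂ) (r ρ : ℝ) (m : E → E) : Prop extends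
    S.IsRealMap r ρ m where
  sub_half_field : ∀ z ∈ ball 0 r, m z - (1 / 2 : ℂ) • S.J (fderiv ℂ χ (m z)) = z

/-- The endpoint of the implicit midpoint step with midpoint `m z`. It replaces the time-one flow
of `χ`: like the flow it is symplectic, but it requires no differential equation to be solved. -/
def midpointStep (χ : E → ℂ) (m : E → E) (z : E) : E :=
  m z + (1 / 2 : ℂ) • S.J (fderiv ℂ χ (m z))

variable {S}

theorem conj_half : conj (1 / 2 : ℂ) = 1 / 2 := by rw [map_div₀, map_one, map_ofNat]

theorem IsHamiltonian.exists_isMidpointMap [CompleteSpace E] [Nontrivial E] {χ : E → ℂ}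
    {ρ σ x : ℝ} (hχ : S.IsHamiltonian ρ x χ) (hσ : 0 < σ) (hxσ : 4 * x ≤ σ) :
    ∃ m, S.IsMidpointMap χ (ρ - σ) ρ m := by
  have hsub : ball (0 : E) (ρ - σ / 2) ⊆ ball 0 ρ := ball_subset_ball (by linarith)
  have hbound : ∀ z ∈ ball 0 ρ, ‖-(1 / 2 : ℂ) • S.J (fderiv ℂ χ z)‖ ≤ x / 2 := fun z hz => by
    rw [norm_smul, norm_neg, norm_div, norm_one, Complex.norm_ofNat]
    linarith [hχ.norm_field_le hz]
  obtain ⟨Ψ, hsource, hΨ, htarget, hholo⟩ := exists_openPartialHomeomorph_id_add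
    (W := fun z => -(1 / 2 : ℂ) • S.J (fderiv ℂ χ z)) hσ
    (hχ.differentiableOn_field.const_smul _) hbound (by linarith)
  have hreal : ∀ y ∈ ball 0 (ρ - σ / 2), Ψ (S.c y) = S.c (Ψ y) := fun y hy => by
    rw [hΨ, hΨ, hχ.field_conj (hsub hy), map_add, map_smulₛₗ, map_neg, conj_half]
  refine ⟨Ψ.symm, ⟨hholo.mono htarget, fun z hz => ?_, fun z hz => ?_⟩, fun z hz => ?_⟩
  · exact hsub (hsource ▸ Ψ.map_target (htarget hz))
  · exact symm_c Ψ hsource hreal (htarget hz)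
  · rw [sub_eq_add_neg, ← neg_smul, ← hΨ, Ψ.right_inv (htarget hz)]

namespace IsMidpointMap

variable {χ : E → ℂ} {r ρ x : ℝ} {m : E → E}

theorem norm_half_field_le (hm : S.IsMidpointMap χ r ρ m) (hχ : S.IsHamiltonian ρ x χ) {z : E}
    (hz : z ∈ ball 0 r) : ‖(1 / 2 : ℂ) • S.J (fderiv ℂ χ (m z))‖ ≤ x / 2 := by
  rw [norm_smul, norm_div, norm_one, Complex.norm_ofNat]
  linarith [hχ.norm_field_le (hm.mapsTo hz)]

theorem norm_sub_le (hm : S.IsMidpointMap χ r ρ m) (hχ : S.IsHamiltonian ρ x χ) {z : E}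
    (hz : z ∈ ball 0 r) : ‖m z - z‖ ≤ x / 2 := by
  have hsub : m z - z = (1 / 2 : ℂ) • S.J (fderiv ℂ χ (m z)) :=
    sub_eq_of_eq_add' (sub_eq_iff_eq_add.1 (hm.sub_half_field z hz))
  exact hsub ▸ hm.norm_half_field_le hχ hz

theorem norm_step_sub_midpoint_le (hm : S.IsMidpointMap χ r ρ m) (hχ : S.IsHamiltonian ρ x χ)
    {z : E} (hz : z ∈ ball 0 r) : ‖S.midpointStep χ m z - m z‖ ≤ x / 2 := by
  rw [midpointStep, add_sub_cancel_left]
  exact hm.norm_half_field_le hχ hz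

theorem norm_step_sub_le (hm : S.IsMidpointMap χ r ρ m) (hχ : S.IsHamiltonian ρ x χ) {z : E}
    (hz : z ∈ ball 0 r) : ‖S.midpointStep χ m z - z‖ ≤ x :=
  calc ‖S.midpointStep χ m z - z‖ ≤ ‖S.midpointStep χ m z - m z‖ + ‖m z - z‖ :=
        norm_sub_le_norm_sub_add_norm_sub _ _ _
    _ ≤ x / 2 + x / 2 :=
        add_le_add (hm.norm_step_sub_midpoint_le hχ hz) (hm.norm_sub_le hχ hz)
    _ = x := add_halves x

theorem energy_step (hm : S.IsMidpointMap χ r ρ m) {z : E} (hz : z ∈ ball 0 r) :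
    S.energy (S.midpointStep χ m z) = S.energy z - fderiv ℂ χ (m z) (S.A (m z)) := by
  rw [midpointStep, energy_midpoint, hm.sub_half_field z hz, S.ω_antisymm, S.ω_J, sub_eq_add_neg]

theorem isRealMap_step (hm : S.IsMidpointMap χ r ρ m) (hχ : S.IsHamiltonian ρ x χ)
    (hrx : r + x ≤ ρ) : S.IsRealMap r ρ (S.midpointStep χ m) where
  holo := hm.holo.add ((hχ.differentiableOn_field.comp hm.holo hm.mapsTo).const_smul _)
  mapsTo z hz := by
    rw [mem_ball_zero_iff] at hz ⊢
    linarith [norm_le_norm_add_norm_sub' (S.midpointStep χ m z) z,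
      hm.norm_step_sub_le hχ (mem_ball_zero_iff.2 hz)]
  real z hz := by
    rw [midpointStep, midpointStep, hm.real z hz, hχ.field_conj (hm.mapsTo hz), map_add,
      map_smulₛₗ, conj_half]

theorem isSymplecticMap_step (hm : S.IsMidpointMap χ r ρ m) (hχ : S.IsHamiltonian ρ x χ)
    (hrx : r + x ≤ ρ) : S.IsSymplecticMap r ρ (S.midpointStep χ m) where
  toIsRealMap := hm.isRealMap_step hχ hrx
  sympl z hz h k := by
    set X := fun z => S.J (fderiv ℂ χ z)
    have hm' := (hm.differentiableAt hz).hasFDerivAt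
    have hX' : HasFDerivAt (fun z => (1 / 2 : ℂ) • X (m z)) _ z :=
      ((hχ.differentiableOn_field.differentiableAt
        (isOpen_ball.mem_nhds (hm.mapsTo hz))).hasFDerivAt.comp z hm').const_smul _
    have hstep : fderiv ℂ (S.midpointStep χ m) z = _ := (hm'.add hX').fderiv
    have hstart := (hm'.sub hX').unique <| (hasFDerivAt_id z).congr_of_eventuallyEq <| by
      filter_upwards [isOpen_ball.mem_nhds hz] with y hy using hm.sub_half_field y hy
    have hcayley := S.ω_cayley
      (hχ.ω_fderiv_field (hm.mapsTo hz) (fderiv ℂ m z h) (fderiv ℂ m z k))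
    rw [hstep]
    exact hcayley.trans <| congrArg₂ (fun h k => S.ω h k) (DFunLike.congr_fun hstart h)
      (DFunLike.congr_fun hstart k)

end IsMidpointMap

end OscillatorSpace

/-! ### The averaging iteration -/

namespace OscillatorSpace

variable {E : Type*} [NormedAddCommGroup E] [NormedSpace ℂ E] (S : OscillatorSpace E)

/-- The remainder left when the Hamiltonian `energy + Z + P` is averaged by the midpoint step of
`generator P`, with midpoint map `m`. -/
def averagedRemainder (Z P : E → ℂ) (m : E → E) (z : E) : ℂ :=
  S.mean P (m z) - S.mean P z + (P (S.midpointStep (S.generator P) m z) - P (m z))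
    + (Z (S.midpointStep (S.generator P) m z) - Z z)

variable {S}

section Averaging

variable {Z P : E → ℂ} {m : E → E} {ρ r a b s : ℝ}

theorem energy_add_averaged (hP : S.IsHamiltonian ρ a P)
    (hm : S.IsMidpointMap (S.generator P) r ρ m) {z : E} (hz : z ∈ ball 0 r) :
    S.energy (S.midpointStep (S.generator P) m z) + Z (S.midpointStep (S.generator P) m z)
        + P (S.midpointStep (S.generator P) m z)
      = S.energy z + (Z z + S.mean P z) + S.averagedRemainder Z P m z := by
  rw [hm.energy_step hz, hP.fderiv_generator_A (hm.mapsTo hz), averagedRemainder]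
  ring

theorem isHamiltonian_averagedRemainder (hZ : S.IsHamiltonian ρ b Z) (hP : S.IsHamiltonian ρ a P)
    (hm : S.IsMidpointMap (S.generator P) (ρ - s / 2) ρ m) (ha : 0 ≤ a) (hb : 0 ≤ b) (hs : 0 < s)
    (hab : 64 * (a + b) ≤ s) :
    S.IsHamiltonian (ρ - s) (a / 4) (S.averagedRemainder Z P m) := by
  have hid : S.IsRealMap (ρ - s / 2) ρ fun z => z := isRealMap_id (by linarith)
  have hstep := hm.isRealMap_step hP.generator (by linarith)
  have hmean := hP.mean.sub_comp hm.toIsRealMap hid ha (half_pos hs) fun z hz =>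
    hm.norm_sub_le hP.generator hz
  have hmid := hP.sub_comp hstep hm.toIsRealMap ha (half_pos hs) fun z hz =>
    hm.norm_step_sub_midpoint_le hP.generator hz
  have hend := hZ.sub_comp hstep hid hb (half_pos hs) fun z hz =>
    hm.norm_step_sub_le hP.generator hz
  refine ((hmean.add hmid).add hend).mono (by linarith) ?_
  calc 2 * (a * (4 * a / 2)) / (s / 2) + 2 * (a * (4 * a / 2)) / (s / 2)
        + 2 * (b * (4 * a)) / (s / 2)
      = a / 4 * (64 * (a + b) / s) := by field_simp; ring
    _ ≤ a / 4 * 1 := by gcongr; exact (div_le_one hs).2 hab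
    _ = a / 4 := mul_one _

end Averaging

variable (S)

/-- A normal form of the Hamiltonian `energy + F` on the ball of radius `r`: a symplectic map `T`
to the ball of radius `ρ`, moving points by at most `e`, which transforms the Hamiltonian into
`energy + Z + P`. Here `Z` commutes with the energy, and the differentials of `Z` and of the
remainder `P` are bounded by `b` and `p`. -/
structure NormalForm (F : E → ℂ) (ρ r e b p : ℝ) where
  T : E → E
  Z : E → ℂ
  P : E → ℂ
  symplectic : S.IsSymplecticMap r ρ T
  norm_T_sub_le : ∀ z ∈ ball 0 r, ‖T z - z‖ ≤ e
  Z_hamiltonian : S.IsHamiltonian r b Z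
  fderiv_Z_A : ∀ z ∈ ball 0 r, fderiv ℂ Z z (S.A z) = 0
  P_hamiltonian : S.IsHamiltonian r p P
  energy_T_add : ∀ z ∈ ball 0 r, S.energy (T z) + F (T z) = S.energy z + Z z + P z

variable {S}

namespace NormalForm

variable {F : E → ℂ} {ρ r e b p : ℝ}

/-- The original Hamiltonian, as a normal form with `Z = 0`. -/
def initial (hF : S.IsHamiltonian ρ p F) : S.NormalForm F ρ ρ 0 0 p where
  T z := z
  Z _ := 0
  P := F
  symplectic := isSymplecticMap_id le_rfl
  norm_T_sub_le z _ := by rw [sub_self, norm_zero]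
  Z_hamiltonian := ⟨differentiableOn_const _, fun _ _ => by simp, fun _ _ => (map_zero _).symm⟩
  fderiv_Z_A _ _ := by rw [fderiv_const_apply, zero_apply]
  P_hamiltonian := hF
  energy_T_add _ _ := by rw [add_zero]

/-- The same normal form on a smaller ball and with weaker bounds. -/
def weaken (N : S.NormalForm F ρ r e b p) {r' e' b' p' : ℝ} (hr : r' ≤ r) (he : e ≤ e')
    (hb : b ≤ b') (hp : p ≤ p') : S.NormalForm F ρ r' e' b' p' where
  T := N.T
  Z := N.Z
  P := N.P
  symplectic := N.symplectic.mono hr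
  norm_T_sub_le z hz := (N.norm_T_sub_le z (ball_subset_ball hr hz)).trans he
  Z_hamiltonian := N.Z_hamiltonian.mono hr hb
  fderiv_Z_A z hz := N.fderiv_Z_A z (ball_subset_ball hr hz)
  P_hamiltonian := N.P_hamiltonian.mono hr hp
  energy_T_add z hz := N.energy_T_add z (ball_subset_ball hr hz)

/-- One averaging step, which moves the mean of the remainder into `Z`. -/
def average (N : S.NormalForm F ρ r e b p) {s : ℝ} {m : E → E}
    (hm : S.IsMidpointMap (S.generator N.P) (r - s / 2) r m) (hp : 0 ≤ p) (hb : 0 ≤ b) (hs : 0 < s)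
    (hpb : 64 * (p + b) ≤ s) : S.NormalForm F ρ (r - s) (e + 4 * p) (b + p) (p / 4) where
  T := N.T ∘ S.midpointStep (S.generator N.P) m
  Z z := N.Z z + S.mean N.P z
  P := S.averagedRemainder N.Z N.P m
  symplectic := (N.symplectic.comp
    (hm.isSymplecticMap_step N.P_hamiltonian.generator (by linarith))).mono (by linarith)
  norm_T_sub_le z hz := by
    have hz' : z ∈ ball 0 (r - s / 2) := ball_subset_ball (by linarith) hz
    have hstep := hm.isRealMap_step N.P_hamiltonian.generator (by linarith)
    exact (norm_sub_le_norm_sub_add_norm_sub _ _ _).trans (add_le_add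
      (N.norm_T_sub_le _ (hstep.mapsTo hz')) (hm.norm_step_sub_le N.P_hamiltonian.generator hz'))
  Z_hamiltonian := (N.Z_hamiltonian.add N.P_hamiltonian.mean).mono (by linarith) le_rfl
  fderiv_Z_A z hz := by
    have hz' : z ∈ ball 0 r := ball_subset_ball (by linarith) hz
    rw [fderiv_fun_add (N.Z_hamiltonian.differentiableAt hz')
      (N.P_hamiltonian.mean.differentiableAt hz'), add_apply, N.fderiv_Z_A z hz',
      N.P_hamiltonian.fderiv_mean_A hz', add_zero]
  P_hamiltonian := isHamiltonian_averagedRemainder N.Z_hamiltonian N.P_hamiltonian hm hp hb hs hpb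
  energy_T_add z hz := by
    have hz' : z ∈ ball 0 (r - s / 2) := ball_subset_ball (by linarith) hz
    have hstep := hm.isRealMap_step N.P_hamiltonian.generator (by linarith)
    rw [Function.comp_apply, N.energy_T_add _ (hstep.mapsTo hz'),
      energy_add_averaged N.P_hamiltonian hm hz']

end NormalForm

theorem IsHamiltonian.nonempty_normalForm [CompleteSpace E] [Nontrivial E] {F : E → ℂ}
    {ρ s a : ℝ} (hF : S.IsHamiltonian ρ a F) (ha : 0 ≤ a) (hs : 0 < s) (has : 128 * a ≤ s)
    (k : ℕ) :
    Nonempty (S.NormalForm F ρ (ρ - k * s) (8 * a * (1 - 4⁻¹ ^ k)) (2 * a * (1 - 4⁻¹ ^ k))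
      (a * 4⁻¹ ^ k)) := by
  induction k with
  | zero => exact ⟨(NormalForm.initial hF).weaken (by simp) (by simp) (by simp) (by simp)⟩
  | succ k ih =>
    obtain ⟨N⟩ := ih
    have hpow : (4⁻¹ : ℝ) ^ k ≤ 1 := pow_le_one₀ (by norm_num) (by norm_num)
    have hp : 0 ≤ a * 4⁻¹ ^ k := by positivity
    have hb : 0 ≤ a * (1 - 4⁻¹ ^ k) := mul_nonneg ha (by linarith)
    obtain ⟨m, hm⟩ := N.P_hamiltonian.generator.exists_isMidpointMap (half_pos hs) (by linarith)
    refine ⟨(N.average hm hp (by linarith) hs (by linarith)).weaken (le_of_eq ?_) ?_ ?_ ?_⟩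
    · push_cast
      ring
    all_goals rw [pow_succ]; linarith

end OscillatorSpace

/-! ### The normal form as a chart -/

namespace OscillatorSpace

variable {E : Type*} [NormedAddCommGroup E] [NormedSpace ℂ E] {S : OscillatorSpace E}

theorem hasFDerivAt_energy (z : E) : HasFDerivAt S.energy (S.ω (S.A z)) z := by
  refine ((hasFDerivAt_bilinear_self (B := S.ω.comp S.A) S.ω_A z).mul_const 2⁻¹).congr_fderiv ?_
  ext k
  simp

theorem isHamiltonian_energy (S : OscillatorSpace E) (r : ℝ) :
    S.IsHamiltonian r (‖S.ω‖ * r) S.energy where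
  holo z _ := (hasFDerivAt_energy z).differentiableAt.differentiableWithinAt
  bound z hz := by
    rw [(hasFDerivAt_energy z).fderiv]
    refine (S.ω.le_opNorm _).trans ?_
    rw [S.norm_A]
    gcongr
    exact (mem_ball_zero_iff.1 hz).le
  real z _ := by simp only [energy, S.A_c, S.ω_c, map_div₀, map_ofNat]

theorem ω_self (x : E) : S.ω x x = 0 := self_eq_neg.1 (S.ω_antisymm x x)

theorem energy_of_real {z : E} (hz : S.c z = z) : S.energy z = ((‖z‖ ^ 2 / 2 : ℝ) : ℂ) := by
  rw [energy, S.ω_A_self z hz, Complex.ofReal_div, Complex.ofReal_ofNat]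

namespace NormalForm

variable {F : E → ℂ} {ρ r r' e b p : ℝ}

theorem image_T_ball_subset (N : S.NormalForm F ρ r e b p) {s t : ℝ} (hs : s ≤ r)
    (hst : s + e ≤ t) : N.T '' ball 0 s ⊆ ball 0 t := by
  rintro _ ⟨z, hz, rfl⟩
  have hT := N.norm_T_sub_le z (ball_subset_ball hs hz)
  rw [mem_ball_zero_iff] at hz ⊢
  linarith [norm_le_norm_add_norm_sub' (N.T z) z]

/-- The transformation of the normal form `N` is the chart `Ψ`, which is biholomorphic from the
ball of radius `r` onto an open set containing the ball of radius `r'`. -/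
structure IsChart (N : S.NormalForm F ρ r e b p) (r' : ℝ) (Ψ : OpenPartialHomeomorph E E) :
    Prop where
  source_eq : Ψ.source = ball 0 r
  apply_eq : ∀ z, Ψ z = N.T z
  ball_subset_target : ball 0 r' ⊆ Ψ.target
  holo_symm : DifferentiableOn ℂ Ψ.symm Ψ.target

theorem exists_isChart [CompleteSpace E] [Nontrivial E] (N : S.NormalForm F ρ r e b p) {σ : ℝ}
    (hσ : 0 < σ) (heσ : 8 * e ≤ σ) :
    ∃ (N' : S.NormalForm F ρ (r - σ / 2) e b p) (Ψ : _), N'.IsChart (r - σ) Ψ := by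
  obtain ⟨Ψ, hsource, hΨ, htarget, hholo⟩ := exists_openPartialHomeomorph_id_add
    (W := fun z => N.T z - z) hσ (N.symplectic.holo.sub differentiableOn_id) N.norm_T_sub_le heσ
  exact ⟨N.weaken (by linarith) le_rfl le_rfl le_rfl, Ψ, hsource,
    fun z => (hΨ z).trans (add_sub_cancel _ _), htarget, hholo⟩

namespace IsChart

variable {N : S.NormalForm F ρ r e b p} {Ψ : OpenPartialHomeomorph E E}

theorem symm_mem_ball (hΨ : N.IsChart r' Ψ) {z : E} (hz : z ∈ Ψ.target) :
    Ψ.symm z ∈ ball 0 r := hΨ.source_eq ▸ Ψ.map_target hz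

theorem T_symm (hΨ : N.IsChart r' Ψ) {z : E} (hz : z ∈ Ψ.target) : N.T (Ψ.symm z) = z := by
  rw [← hΨ.apply_eq, Ψ.right_inv hz]

theorem norm_symm_sub_le (hΨ : N.IsChart r' Ψ) {z : E} (hz : z ∈ Ψ.target) :
    ‖Ψ.symm z - z‖ ≤ e := by
  have h := N.norm_T_sub_le _ (hΨ.symm_mem_ball hz)
  rwa [hΨ.T_symm hz, norm_sub_rev] at h

theorem image_T (hΨ : N.IsChart r' Ψ) : N.T '' ball 0 r = Ψ.target := by
  rw [← Ψ.image_source_eq_target, hΨ.source_eq, funext hΨ.apply_eq]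

theorem ball_subset_image_T (hΨ : N.IsChart r' Ψ) {s t : ℝ} (hs : s ≤ r') (hst : s + e ≤ t) :
    ball 0 s ⊆ N.T '' ball 0 t := by
  intro z hz
  have htarget := hΨ.ball_subset_target (ball_subset_ball hs hz)
  have hsymm := hΨ.norm_symm_sub_le htarget
  refine ⟨Ψ.symm z, ?_, hΨ.T_symm htarget⟩
  rw [mem_ball_zero_iff] at hz ⊢
  linarith [norm_le_norm_add_norm_sub' (Ψ.symm z) z]

theorem symm_of_real (hΨ : N.IsChart r' Ψ) {z : E} (hz : z ∈ Ψ.target) (hc : S.c z = z) :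
    S.c (Ψ.symm z) = Ψ.symm z := by
  have hreal : ∀ x ∈ ball 0 r, Ψ (S.c x) = S.c (Ψ x) := fun x hx => by
    rw [hΨ.apply_eq, hΨ.apply_eq, N.symplectic.real x hx]
  rw [← symm_c Ψ hΨ.source_eq hreal hz, hc]

theorem hasFDerivAt_symm (hΨ : N.IsChart r' Ψ) {z : E} (hz : z ∈ Ψ.target) :
    HasFDerivAt Ψ.symm (fderiv ℂ Ψ.symm z) z :=
  (hΨ.holo_symm.differentiableAt (Ψ.open_target.mem_nhds hz)).hasFDerivAt

theorem fderiv_T_comp_fderiv_symm (hΨ : N.IsChart r' Ψ) {z : E} (hz : z ∈ Ψ.target) :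
    (fderiv ℂ N.T (Ψ.symm z)).comp (fderiv ℂ Ψ.symm z) = ContinuousLinearMap.id ℂ E := by
  have hT := (N.symplectic.differentiableAt (hΨ.symm_mem_ball hz)).hasFDerivAt
  refine (hT.comp z (hΨ.hasFDerivAt_symm hz)).unique
    ((hasFDerivAt_id z).congr_of_eventuallyEq ?_)
  filter_upwards [Ψ.open_target.mem_nhds hz] with y hy using hΨ.T_symm hy

theorem fderiv_comp_fderiv_T (hΨ : N.IsChart r' Ψ) {z : E} (hz : z ∈ Ψ.target)
    (hF : DifferentiableAt ℂ F z) :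
    (fderiv ℂ (fun z => S.energy z + F z) z).comp (fderiv ℂ N.T (Ψ.symm z))
      = S.ω (S.A (Ψ.symm z)) + fderiv ℂ N.Z (Ψ.symm z) + fderiv ℂ N.P (Ψ.symm z) := by
  have hw := hΨ.symm_mem_ball hz
  have hH := ((hasFDerivAt_energy (S := S) z).differentiableAt.add hF).hasFDerivAt
  rw [← hΨ.T_symm hz] at hH
  have hHT := hH.comp _ (N.symplectic.differentiableAt hw).hasFDerivAt
  rw [hΨ.T_symm hz] at hHT
  refine hHT.unique (HasFDerivAt.congr_of_eventuallyEq
    (((hasFDerivAt_energy _).add (N.Z_hamiltonian.differentiableAt hw).hasFDerivAt).add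
      (N.P_hamiltonian.differentiableAt hw).hasFDerivAt) ?_)
  filter_upwards [isOpen_ball.mem_nhds hw] with y hy using N.energy_T_add y hy

theorem ω_pullback_field (hΨ : N.IsChart r' Ψ) {z : E} (hz : z ∈ Ψ.target)
    (hF : DifferentiableAt ℂ F z) (k : E) :
    S.ω (fderiv ℂ Ψ.symm z (S.J (fderiv ℂ (fun z => S.energy z + F z) z))) k
      = S.ω (S.A (Ψ.symm z)) k + fderiv ℂ N.Z (Ψ.symm z) k + fderiv ℂ N.P (Ψ.symm z) k := by
  rw [← N.symplectic.sympl _ (hΨ.symm_mem_ball hz),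
    ← ContinuousLinearMap.comp_apply (fderiv ℂ N.T (Ψ.symm z)),
    hΨ.fderiv_T_comp_fderiv_symm hz, ContinuousLinearMap.id_apply, S.ω_J,
    ← ContinuousLinearMap.comp_apply, hΨ.fderiv_comp_fderiv_T hz hF, add_apply, add_apply]

theorem norm_fderiv_energy_pullback_field_le (hΨ : N.IsChart r' Ψ) {z : E} (hz : z ∈ Ψ.target)
    (hF : DifferentiableAt ℂ F z) :
    ‖S.ω (S.A (Ψ.symm z))
      (fderiv ℂ Ψ.symm z (S.J (fderiv ℂ (fun z => S.energy z + F z) z)))‖ ≤ p * r := by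
  have hw := hΨ.symm_mem_ball hz
  rw [S.ω_antisymm, norm_neg, hΨ.ω_pullback_field hz hF, ω_self, N.fderiv_Z_A _ hw, zero_add,
    zero_add]
  refine ((fderiv ℂ N.P (Ψ.symm z)).le_of_opNorm_le (N.P_hamiltonian.bound _ hw) _).trans ?_
  rw [S.norm_A]
  exact mul_le_mul_of_nonneg_left (mem_ball_zero_iff.1 hw).le (N.P_hamiltonian.bound_nonneg hw)

theorem norm_fderiv_Z_pullback_field_le (hΨ : N.IsChart r' Ψ) {z : E} (hz : z ∈ Ψ.target)
    (hF : DifferentiableAt ℂ F z) :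
    ‖fderiv ℂ N.Z (Ψ.symm z)
      (fderiv ℂ Ψ.symm z (S.J (fderiv ℂ (fun z => S.energy z + F z) z)))‖ ≤ p * b := by
  have hw := hΨ.symm_mem_ball hz
  rw [← S.ω_J (fderiv ℂ N.Z (Ψ.symm z)), S.ω_antisymm, norm_neg, hΨ.ω_pullback_field hz hF,
    S.ω_antisymm (S.A _), S.ω_J, N.fderiv_Z_A _ hw, ← S.ω_J (fderiv ℂ N.Z (Ψ.symm z)), ω_self,
    neg_zero, zero_add, zero_add]
  refine ((fderiv ℂ N.P (Ψ.symm z)).le_of_opNorm_le (N.P_hamiltonian.bound _ hw) _).trans ?_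
  exact mul_le_mul_of_nonneg_left (N.Z_hamiltonian.norm_field_le hw)
    (N.P_hamiltonian.bound_nonneg hw)

end IsChart

end NormalForm

theorem IsHamiltonian.exists_normalForm_isChart [CompleteSpace E] [Nontrivial E] {F : E → ℂ}
    {R δ κ : ℝ} {k : ℕ} (hF : S.IsHamiltonian R (κ * R) F) (hR : 0 < R) (hκ : 0 < κ)
    (hκδ : 64 * κ ≤ δ) (hk : k * (128 * κ) ≤ δ / 2) :
    ∃ (N : S.NormalForm F R (R * (1 - δ)) (8 * κ * R) (2 * κ * R) (κ * R * 4⁻¹ ^ k)) (Ψ : _),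
      N.IsChart (R * (1 - 3 / 2 * δ)) Ψ := by
  have hκR : 0 < κ * R := mul_pos hκ hR
  have hpow : (0 : ℝ) ≤ 4⁻¹ ^ k := by positivity
  obtain ⟨N⟩ := hF.nonempty_normalForm hκR.le (by positivity) le_rfl k
  have hradius : R * (1 - δ / 2) ≤ R - k * (128 * (κ * R)) := by
    linarith [mul_le_mul_of_nonneg_right hk hR.le]
  have hloss : κ * R * (1 - 4⁻¹ ^ k) ≤ κ * R := mul_le_of_le_one_right hκR.le (by linarith)
  obtain ⟨N', Ψ, hΨ⟩ := (N.weaken (e' := 8 * κ * R) (b' := 2 * κ * R) hradius (by linarith)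
    (by linarith) le_rfl).exists_isChart (σ := δ * R) (by nlinarith) (by nlinarith)
  rw [show R * (1 - δ) = R * (1 - δ / 2) - δ * R / 2 by ring,
    show R * (1 - 3 / 2 * δ) = R * (1 - δ / 2) - δ * R by ring]
  exact ⟨N', Ψ, hΨ⟩

variable [NormedSpace ℝ E] [IsScalarTower ℝ ℂ E]

variable (S) in
/-- Real curves on the time interval `[-τ, τ]` that solve Hamilton's equations for `H` at the times
when they lie in the set `U`. -/
structure IsRealOrbitIn (H : E → ℂ) (U : Set E) (τ : ℝ) (y : ℝ → E) : Prop where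
  continuousOn : ContinuousOn y (Icc (-τ) τ)
  real : ∀ t ∈ Icc (-τ) τ, S.c (y t) = y t
  hasDerivWithinAt : ∀ t ∈ Icc (-τ) τ, y t ∈ U →
    HasDerivWithinAt y (S.J (fderiv ℂ H (y t))) (Icc (-τ) τ) t

theorem uIcc_zero_subset_Icc {τ t : ℝ} (ht : t ∈ Icc (-τ) τ) : uIcc 0 t ⊆ Icc (-τ) τ := by
  have hτ : 0 ≤ τ := by linarith [ht.1, ht.2]
  exact ordConnected_Icc.uIcc_subset ⟨neg_nonpos.2 hτ, hτ⟩ ht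

namespace IsRealOrbitIn

variable {H : E → ℂ} {U : Set E} {τ : ℝ} {y : ℝ → E}

theorem norm_comp_sub_le (hy : S.IsRealOrbitIn H U τ y) {f : E → ℂ} {f' : E → E →L[ℂ] ℂ} {B : ℝ}
    (hf : ∀ z ∈ U, HasFDerivAt f (f' z) z) (hB : ∀ z ∈ U, ‖f' z (S.J (fderiv ℂ H z))‖ ≤ B)
    {t : ℝ} (ht : t ∈ Icc (-τ) τ) (hyU : ∀ s ∈ uIcc 0 t, y s ∈ U) :
    ‖f (y t) - f (y 0)‖ ≤ B * |t| := by
  have hsub := uIcc_zero_subset_Icc ht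
  have hderiv : ∀ s ∈ uIcc 0 t, HasDerivWithinAt (f ∘ y)
      (f' (y s) (S.J (fderiv ℂ H (y s)))) (uIcc 0 t) s := fun s hs =>
    ((hf _ (hyU s hs)).restrictScalars ℝ).comp_hasDerivWithinAt s
      ((hy.hasDerivWithinAt s (hsub hs) (hyU s hs)).mono hsub)
  have hbound := (convex_uIcc 0 t).norm_image_sub_le_of_norm_hasDerivWithin_le hderiv
    (fun s hs => hB _ (hyU s hs)) left_mem_uIcc right_mem_uIcc
  rwa [sub_zero, Real.norm_eq_abs] at hbound

variable {F : E → ℂ} {ρ r r' e b p : ℝ} {N : S.NormalForm F ρ r e b p}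
  {Ψ : OpenPartialHomeomorph E E}

theorem norm_energy_symm_sub_le
    (hy : S.IsRealOrbitIn (fun z => S.energy z + F z) (ball 0 r') τ y) (hΨ : N.IsChart r' Ψ)
    (hF : ∀ z ∈ ball 0 r', DifferentiableAt ℂ F z) {t : ℝ} (ht : t ∈ Icc (-τ) τ)
    (hyr : ∀ s ∈ uIcc 0 t, y s ∈ ball 0 r') :
    ‖S.energy (Ψ.symm (y t)) - S.energy (Ψ.symm (y 0))‖ ≤ p * r * |t| :=
  hy.norm_comp_sub_le
    (fun _ hz => (hasFDerivAt_energy _).comp _ (hΨ.hasFDerivAt_symm (hΨ.ball_subset_target hz)))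
    (fun z hz => hΨ.norm_fderiv_energy_pullback_field_le (hΨ.ball_subset_target hz) (hF z hz))
    ht hyr

theorem norm_Z_symm_sub_le
    (hy : S.IsRealOrbitIn (fun z => S.energy z + F z) (ball 0 r') τ y) (hΨ : N.IsChart r' Ψ)
    (hF : ∀ z ∈ ball 0 r', DifferentiableAt ℂ F z) {t : ℝ} (ht : t ∈ Icc (-τ) τ)
    (hyr : ∀ s ∈ uIcc 0 t, y s ∈ ball 0 r') :
    ‖N.Z (Ψ.symm (y t)) - N.Z (Ψ.symm (y 0))‖ ≤ p * b * |t| :=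
  hy.norm_comp_sub_le
    (fun _ hz =>
      have hz := hΨ.ball_subset_target hz
      (N.Z_hamiltonian.differentiableAt (hΨ.symm_mem_ball hz)).hasFDerivAt.comp _
        (hΨ.hasFDerivAt_symm hz))
    (fun z hz => hΨ.norm_fderiv_Z_pullback_field_le (hΨ.ball_subset_target hz) (hF z hz)) ht hyr

end IsRealOrbitIn

end OscillatorSpace

/-! ### Confinement of real orbits -/

theorem forall_mem_Icc_lt_of_bootstrap {f : ℝ → ℝ} {a b r₁ r₂ : ℝ} (hf : ContinuousOn f (Icc a b))
    (ha : f a ≤ r₂) (hr : r₂ < r₁)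
    (h : ∀ t ∈ Icc a b, (∀ s ∈ Icc a t, f s ≤ r₁) → f t ≤ r₂) : ∀ t ∈ Icc a b, f t < r₁ := by
  by_contra! hcon
  obtain ⟨t, ht, hft⟩ := hcon
  have hcompact : IsCompact (Icc a b ∩ f ⁻¹' {r₁}) :=
    isCompact_Icc.of_isClosed_subset (hf.preimage_isClosed_of_isClosed isClosed_Icc
      isClosed_singleton) inter_subset_left
  have hhits : ∀ u ∈ Icc a b, r₁ ≤ f u → ∃ v ∈ Icc a u, f v = r₁ := fun u hu hfu =>
    intermediate_value_Icc hu.1 (hf.mono (Icc_subset_Icc_right hu.2)) ⟨ha.trans hr.le, hfu⟩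
  obtain ⟨v, hv, hfv⟩ := hhits t ht hft
  obtain ⟨u, ⟨hu, hfu⟩, hleast⟩ := hcompact.exists_isLeast
    ⟨v, Icc_subset_Icc_right ht.2 hv, hfv⟩
  refine absurd (h u hu fun s hs => ?_) (not_le.2 (hfu.symm ▸ hr))
  by_contra! hfs
  obtain ⟨w, hw, hfw⟩ := hhits s ⟨hs.1, hs.2.trans hu.2⟩ hfs.le
  have huw : u ≤ w := hleast ⟨⟨hw.1, (hw.2.trans hs.2).trans hu.2⟩, hfw⟩
  have hsu : s = u := le_antisymm hs.2 (huw.trans hw.2)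
  exact hfs.ne' (hsu ▸ hfu)

theorem forall_mem_Icc_neg_le_of_bootstrap {f : ℝ → ℝ} {τ r₁ r₂ : ℝ}
    (hf : ContinuousOn f (Icc (-τ) τ)) (h0 : f 0 ≤ r₂) (hr : r₂ < r₁)
    (h : ∀ t ∈ Icc (-τ) τ, (∀ s ∈ uIcc 0 t, f s ≤ r₁) → f t ≤ r₂) :
    ∀ t ∈ Icc (-τ) τ, f t ≤ r₂ := by
  intro t ht
  have hsub := OscillatorSpace.uIcc_zero_subset_Icc ht
  refine h t ht fun s hs => ?_
  rcases le_total 0 t with ht0 | ht0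
  · rw [uIcc_of_le ht0] at hs hsub
    exact (forall_mem_Icc_lt_of_bootstrap (hf.mono hsub) h0 hr
      (fun s hs hle => h s (hsub hs) (by rwa [uIcc_of_le hs.1])) s hs).le
  · rw [uIcc_of_ge ht0] at hs hsub
    have hneg : ∀ {s}, s ∈ Icc 0 (-t) → -s ∈ Icc t 0 := fun hs =>
      ⟨by linarith [hs.2], by linarith [hs.1]⟩
    have hlt := forall_mem_Icc_lt_of_bootstrap (f := fun s => f (-s))
      ((hf.mono hsub).comp continuousOn_neg fun _ => hneg) (by rwa [neg_zero]) hr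
      fun s hs hle => h (-s) (hsub (hneg hs)) fun u hu => by
        rw [uIcc_of_ge (neg_nonpos.2 hs.1)] at hu
        simpa only [neg_neg] using hle (-u) ⟨by linarith [hu.2], by linarith [hu.1]⟩
    simpa only [neg_neg] using (hlt (-s) ⟨by linarith [hs.2], by linarith [hs.1]⟩).le

namespace OscillatorSpace

variable {E : Type*} [NormedAddCommGroup E] [NormedSpace ℂ E] {S : OscillatorSpace E}

theorem norm_energy_sub_of_real {z w : E} (hz : S.c z = z) (hw : S.c w = w) :
    ‖S.energy z - S.energy w‖ = |‖z‖ ^ 2 - ‖w‖ ^ 2| / 2 := by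
  rw [energy_of_real hz, energy_of_real hw, ← Complex.ofReal_sub, Complex.norm_real,
    Real.norm_eq_abs, ← sub_div, abs_div, abs_two]

namespace NormalForm.IsChart

variable {F : E → ℂ} {ρ r r' e b p : ℝ} {N : S.NormalForm F ρ r e b p}
  {Ψ : OpenPartialHomeomorph E E} {z : E}

theorem norm_energy_sub_symm_le (hΨ : N.IsChart r' Ψ) (hrr : r' ≤ r) (hz : z ∈ ball 0 r')
    (hc : S.c z = z) : ‖S.energy z - S.energy (Ψ.symm z)‖ ≤ r * e := by
  have htarget := hΨ.ball_subset_target hz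
  have hsymm := (mem_ball_zero_iff.1 (hΨ.symm_mem_ball htarget)).le
  rw [mem_ball_zero_iff] at hz
  have hdist : |‖z‖ - ‖Ψ.symm z‖| ≤ e := (abs_norm_sub_norm_le _ _).trans
    (norm_sub_rev z _ ▸ hΨ.norm_symm_sub_le htarget)
  rw [norm_energy_sub_of_real hc (hΨ.symm_of_real htarget hc), sq_sub_sq, abs_mul,
    abs_of_nonneg (by positivity), mul_div_right_comm]
  exact mul_le_mul (by linarith) hdist (abs_nonneg _) (by linarith [norm_nonneg z])

theorem norm_Z_sub_symm_le (hΨ : N.IsChart r' Ψ) (hrr : r' ≤ r) (hz : z ∈ ball 0 r') :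
    ‖N.Z z - N.Z (Ψ.symm z)‖ ≤ b * e := by
  have htarget := hΨ.ball_subset_target hz
  have hzr := ball_subset_ball hrr hz
  refine (N.Z_hamiltonian.norm_sub_le (hΨ.symm_mem_ball htarget) hzr).trans ?_
  rw [norm_sub_rev]
  exact mul_le_mul_of_nonneg_left (hΨ.norm_symm_sub_le htarget) (N.Z_hamiltonian.bound_nonneg hzr)

end NormalForm.IsChart

namespace IsRealOrbitIn

variable [NormedSpace ℝ E] [IsScalarTower ℝ ℂ E]

variable {F : E → ℂ} {R δ κ q τ : ℝ} {y : ℝ → E}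
  {N : S.NormalForm F R (R * (1 - δ)) (8 * κ * R) (2 * κ * R) (κ * R * q)}
  {Ψ : OpenPartialHomeomorph E E}

theorem norm_energy_symm_sub_le_of_confined
    (hy : S.IsRealOrbitIn (fun z => S.energy z + F z) (ball 0 (R * (1 - 3 / 2 * δ))) τ y)
    (hΨ : N.IsChart (R * (1 - 3 / 2 * δ)) Ψ)
    (hF : ∀ z ∈ ball 0 (R * (1 - 3 / 2 * δ)), DifferentiableAt ℂ F z) (hR : 0 < R) (hδ : 0 < δ)
    (hκ : 0 ≤ κ) (hq : 0 ≤ q) (hqτ : q * τ ≤ 1) {t : ℝ} (ht : t ∈ Icc (-τ) τ)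
    (hyr : ∀ s ∈ uIcc 0 t, y s ∈ ball 0 (R * (1 - 3 / 2 * δ))) :
    ‖S.energy (Ψ.symm (y t)) - S.energy (Ψ.symm (y 0))‖ ≤ κ * R ^ 2 :=
  calc _ ≤ κ * R * q * (R * (1 - δ)) * |t| := hy.norm_energy_symm_sub_le hΨ hF ht hyr
    _ ≤ κ * R * q * (R * 1) * τ := by
      gcongr
      · linarith
      · exact abs_le.2 ht
    _ = κ * R ^ 2 * (q * τ) := by ring
    _ ≤ κ * R ^ 2 := mul_le_of_le_one_right (by positivity) hqτ

theorem norm_Z_symm_sub_le_of_confined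
    (hy : S.IsRealOrbitIn (fun z => S.energy z + F z) (ball 0 (R * (1 - 3 / 2 * δ))) τ y)
    (hΨ : N.IsChart (R * (1 - 3 / 2 * δ)) Ψ)
    (hF : ∀ z ∈ ball 0 (R * (1 - 3 / 2 * δ)), DifferentiableAt ℂ F z) (hR : 0 < R)
    (hκ : 0 ≤ κ) (hq : 0 ≤ q) (hqτ : q * τ ≤ 1) {t : ℝ} (ht : t ∈ Icc (-τ) τ)
    (hyr : ∀ s ∈ uIcc 0 t, y s ∈ ball 0 (R * (1 - 3 / 2 * δ))) :
    ‖N.Z (Ψ.symm (y t)) - N.Z (Ψ.symm (y 0))‖ ≤ 2 * κ ^ 2 * R ^ 2 :=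
  calc _ ≤ κ * R * q * (2 * κ * R) * |t| := hy.norm_Z_symm_sub_le hΨ hF ht hyr
    _ ≤ κ * R * q * (2 * κ * R) * τ := by gcongr; exact abs_le.2 ht
    _ = 2 * κ ^ 2 * R ^ 2 * (q * τ) := by ring
    _ ≤ 2 * κ ^ 2 * R ^ 2 := mul_le_of_le_one_right (by positivity) hqτ

theorem norm_le_of_confined
    (hy : S.IsRealOrbitIn (fun z => S.energy z + F z) (ball 0 (R * (1 - 3 / 2 * δ))) τ y)
    (hΨ : N.IsChart (R * (1 - 3 / 2 * δ)) Ψ)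
    (hF : ∀ z ∈ ball 0 (R * (1 - 3 / 2 * δ)), DifferentiableAt ℂ F z) (hR : 0 < R)
    (hδ : δ ≤ 1 / 4) (hκ : 0 ≤ κ) (hκδ : 80 * κ < δ) (hq : 0 ≤ q) (hqτ : q * τ ≤ 1)
    (hy0 : ‖y 0‖ < R * (1 - 3 * δ)) {t : ℝ} (ht : t ∈ Icc (-τ) τ)
    (hyr : ∀ s ∈ uIcc 0 t, y s ∈ ball 0 (R * (1 - 3 / 2 * δ))) :
    ‖y t‖ ≤ R * (1 - 5 / 2 * δ) := by
  have htarget : ∀ s ∈ uIcc 0 t, y s ∈ Ψ.target := fun s hs => hΨ.ball_subset_target (hyr s hs)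
  have hreal : ∀ s ∈ uIcc 0 t, S.c (Ψ.symm (y s)) = Ψ.symm (y s) := fun s hs =>
    hΨ.symm_of_real (htarget s hs) (hy.real s (uIcc_zero_subset_Icc ht hs))
  have hdrift := hy.norm_energy_symm_sub_le_of_confined hΨ hF hR (by linarith) hκ hq hqτ ht hyr
  rw [norm_energy_sub_of_real (hreal t right_mem_uIcc) (hreal 0 left_mem_uIcc)] at hdrift
  have hstart : ‖Ψ.symm (y 0)‖ ≤ R * (1 - 3 * δ) + 8 * κ * R :=
    (norm_le_norm_add_norm_sub' _ (y 0)).trans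
      (add_le_add hy0.le (hΨ.norm_symm_sub_le (htarget 0 left_mem_uIcc)))
  have hκR : 0 ≤ κ * R := by positivity
  have hx : R / 4 ≤ R * (1 - 3 * δ) + 8 * κ * R := by
    have hRδ : R * (1 - 3 * (1 / 4)) ≤ R * (1 - 3 * δ) := by gcongr
    linarith
  generalize hx_def : R * (1 - 3 * δ) + 8 * κ * R = x at hx hstart
  have hsq : ‖Ψ.symm (y t)‖ ^ 2 ≤ (x + 4 * (κ * R)) ^ 2 := by
    have hsq0 : ‖Ψ.symm (y 0)‖ ^ 2 ≤ x ^ 2 := by gcongr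
    have hxκ : R / 4 * (8 * (κ * R)) ≤ x * (8 * (κ * R)) := by gcongr
    linarith [(abs_le.1 ((div_le_iff₀ two_pos).1 hdrift)).2, sq_nonneg (4 * (κ * R))]
  have hend : ‖Ψ.symm (y t)‖ ≤ x + 4 * (κ * R) := le_of_sq_le_sq hsq (by linarith)
  have hκδR : 80 * κ * R ≤ δ * R := by gcongr
  linarith [norm_le_norm_add_norm_sub (Ψ.symm (y t)) (y t),
    hΨ.norm_symm_sub_le (htarget t right_mem_uIcc)]

theorem norm_le
    (hy : S.IsRealOrbitIn (fun z => S.energy z + F z) (ball 0 (R * (1 - 3 / 2 * δ))) τ y)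
    (hΨ : N.IsChart (R * (1 - 3 / 2 * δ)) Ψ)
    (hF : ∀ z ∈ ball 0 (R * (1 - 3 / 2 * δ)), DifferentiableAt ℂ F z) (hR : 0 < R)
    (hδ : δ ≤ 1 / 4) (hκ : 0 ≤ κ) (hκδ : 80 * κ < δ) (hq : 0 ≤ q) (hqτ : q * τ ≤ 1)
    (hy0 : ‖y 0‖ < R * (1 - 3 * δ)) : ∀ t ∈ Icc (-τ) τ, ‖y t‖ ≤ R * (1 - 5 / 2 * δ) := by
  have hRδ : 0 < R * δ := mul_pos hR (by linarith)
  refine forall_mem_Icc_neg_le_of_bootstrap (r₁ := R * (1 - 2 * δ)) hy.continuousOn.norm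
    (by linarith) (by linarith) fun t ht hle =>
      hy.norm_le_of_confined hΨ hF hR hδ hκ hκδ hq hqτ hy0 ht fun s hs => ?_
  rw [mem_ball_zero_iff]
  linarith [hle s hs]

theorem mem_ball
    (hy : S.IsRealOrbitIn (fun z => S.energy z + F z) (ball 0 (R * (1 - 3 / 2 * δ))) τ y)
    (hΨ : N.IsChart (R * (1 - 3 / 2 * δ)) Ψ)
    (hF : ∀ z ∈ ball 0 (R * (1 - 3 / 2 * δ)), DifferentiableAt ℂ F z) (hR : 0 < R)
    (hδ : δ ≤ 1 / 4) (hκ : 0 ≤ κ) (hκδ : 80 * κ < δ) (hq : 0 ≤ q) (hqτ : q * τ ≤ 1)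
    (hy0 : ‖y 0‖ < R * (1 - 3 * δ)) {t : ℝ} (ht : t ∈ Icc (-τ) τ) :
    y t ∈ ball 0 (R * (1 - 3 / 2 * δ)) := by
  have hRδ : 0 < R * δ := mul_pos hR (by linarith)
  rw [mem_ball_zero_iff]
  linarith [hy.norm_le hΨ hF hR hδ hκ hκδ hq hqτ hy0 t ht]

theorem norm_energy_sub_le
    (hy : S.IsRealOrbitIn (fun z => S.energy z + F z) (ball 0 (R * (1 - 3 / 2 * δ))) τ y)
    (hΨ : N.IsChart (R * (1 - 3 / 2 * δ)) Ψ)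
    (hF : ∀ z ∈ ball 0 (R * (1 - 3 / 2 * δ)), DifferentiableAt ℂ F z) (hR : 0 < R)
    (hδ : δ ≤ 1 / 4) (hκ : 0 ≤ κ) (hκδ : 80 * κ < δ) (hq : 0 ≤ q) (hqτ : q * τ ≤ 1)
    (hy0 : ‖y 0‖ < R * (1 - 3 * δ)) {t : ℝ} (ht : t ∈ Icc (-τ) τ) :
    ‖S.energy (y t) - S.energy (y 0)‖ ≤ 17 * κ * R ^ 2 := by
  have hsub := uIcc_zero_subset_Icc ht
  have hyr : ∀ s ∈ uIcc 0 t, y s ∈ ball 0 (R * (1 - 3 / 2 * δ)) := fun s hs =>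
    hy.mem_ball hΨ hF hR hδ hκ hκδ hq hqτ hy0 (hsub hs)
  have hRδ : 0 ≤ R * δ := mul_nonneg hR.le (by linarith)
  have hcompare : ∀ s ∈ uIcc 0 t, ‖S.energy (y s) - S.energy (Ψ.symm (y s))‖ ≤ 8 * κ * R ^ 2 :=
    fun s hs => (hΨ.norm_energy_sub_symm_le (by linarith) (hyr s hs)
      (hy.real s (hsub hs))).trans <| by
        have : 0 ≤ 8 * κ * R * (R * δ) := by positivity
        linarith
  have hdrift := hy.norm_energy_symm_sub_le_of_confined hΨ hF hR (by linarith) hκ hq hqτ ht hyr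
  calc _ = ‖(S.energy (y t) - S.energy (Ψ.symm (y t)))
          + (S.energy (Ψ.symm (y t)) - S.energy (Ψ.symm (y 0)))
          - (S.energy (y 0) - S.energy (Ψ.symm (y 0)))‖ := by congr 1; ring
    _ ≤ 8 * κ * R ^ 2 + κ * R ^ 2 + 8 * κ * R ^ 2 :=
      norm_sub_le_of_le (norm_add_le_of_le (hcompare t right_mem_uIcc) hdrift)
        (hcompare 0 left_mem_uIcc)
    _ = 17 * κ * R ^ 2 := by ring

theorem norm_Z_sub_le
    (hy : S.IsRealOrbitIn (fun z => S.energy z + F z) (ball 0 (R * (1 - 3 / 2 * δ))) τ y)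
    (hΨ : N.IsChart (R * (1 - 3 / 2 * δ)) Ψ)
    (hF : ∀ z ∈ ball 0 (R * (1 - 3 / 2 * δ)), DifferentiableAt ℂ F z) (hR : 0 < R)
    (hδ : δ ≤ 1 / 4) (hκ : 0 ≤ κ) (hκδ : 80 * κ < δ) (hq : 0 ≤ q) (hqτ : q * τ ≤ 1)
    (hy0 : ‖y 0‖ < R * (1 - 3 * δ)) {t : ℝ} (ht : t ∈ Icc (-τ) τ) :
    ‖N.Z (y t) - N.Z (y 0)‖ ≤ 34 * κ ^ 2 * R ^ 2 := by
  have hyr : ∀ s ∈ uIcc 0 t, y s ∈ ball 0 (R * (1 - 3 / 2 * δ)) := fun s hs =>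
    hy.mem_ball hΨ hF hR hδ hκ hκδ hq hqτ hy0 (uIcc_zero_subset_Icc ht hs)
  have hRδ : 0 ≤ R * δ := mul_nonneg hR.le (by linarith)
  have hcompare : ∀ s ∈ uIcc 0 t,
      ‖N.Z (y s) - N.Z (Ψ.symm (y s))‖ ≤ 2 * κ * R * (8 * κ * R) :=
    fun s hs => hΨ.norm_Z_sub_symm_le (by linarith) (hyr s hs)
  have hdrift := hy.norm_Z_symm_sub_le_of_confined hΨ hF hR hκ hq hqτ ht hyr
  calc _ = ‖(N.Z (y t) - N.Z (Ψ.symm (y t))) + (N.Z (Ψ.symm (y t)) - N.Z (Ψ.symm (y 0)))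
          - (N.Z (y 0) - N.Z (Ψ.symm (y 0)))‖ := by congr 1; ring
    _ ≤ 2 * κ * R * (8 * κ * R) + 2 * κ ^ 2 * R ^ 2 + 2 * κ * R * (8 * κ * R) :=
      norm_sub_le_of_le (norm_add_le_of_le (hcompare t right_mem_uIcc) hdrift)
        (hcompare 0 left_mem_uIcc)
    _ = 34 * κ ^ 2 * R ^ 2 := by ring

end IsRealOrbitIn

end OscillatorSpace

/-! ### Existence of real orbits -/

section RadialRetraction

variable {E : Type*} [NormedAddCommGroup E] [NormedSpace ℝ E] {r : ℝ}

/-- The radial retraction of a normed space onto the closed ball of radius `r > 0`. It serves to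
extend a vector field on a ball to a globally Lipschitz one. -/
def radialRetraction (r : ℝ) (z : E) : E := (r / max r ‖z‖) • z

theorem radialRetraction_of_norm_le (hr : 0 < r) {z : E} (hz : ‖z‖ ≤ r) :
    radialRetraction r z = z := by
  rw [radialRetraction, max_eq_left hz, div_self hr.ne', one_smul]

theorem norm_radialRetraction_le (hr : 0 < r) (z : E) : ‖radialRetraction r z‖ ≤ r := by
  rw [radialRetraction, norm_smul, Real.norm_of_nonneg (by positivity), div_mul_eq_mul_div,
    div_le_iff₀ (by positivity)]
  exact mul_le_mul_of_nonneg_left (le_max_right _ _) hr.le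

theorem lipschitzWith_radialRetraction (hr : 0 < r) :
    LipschitzWith 2 (radialRetraction r : E → E) := by
  refine LipschitzWith.of_dist_le_mul fun x y => ?_
  rw [dist_eq_norm, dist_eq_norm, NNReal.coe_ofNat, two_mul]
  set a := max r ‖x‖
  set b := max r ‖y‖
  have ha : 0 < a := lt_max_of_lt_left hr
  have hb : 0 < b := lt_max_of_lt_left hr
  have hcoeff : |r / a - r / b| * ‖y‖ ≤ ‖x - y‖ := by
    have hba : |b - a| ≤ ‖x - y‖ := by
      simpa only [sub_self, abs_zero, norm_nonneg, max_eq_right, abs_nonneg, norm_sub_rev] using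
        (abs_max_sub_max_le_max r ‖y‖ r ‖x‖).trans
          (max_le_max_left _ (abs_norm_sub_norm_le y x))
    calc |r / a - r / b| * ‖y‖ = |b - a| * ((r / a) * (‖y‖ / b)) := by
          rw [show r / a - r / b = (b - a) * (r / (a * b)) by field_simp, abs_mul,
            abs_of_nonneg (by positivity : 0 ≤ r / (a * b))]
          field_simp
      _ ≤ ‖x - y‖ * (1 * 1) := by
          gcongr
          · exact (div_le_one ha).2 (le_max_left _ _)
          · exact (div_le_one hb).2 (le_max_right _ _)
      _ = ‖x - y‖ := by ring
  calc ‖radialRetraction r x - radialRetraction r y‖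
      = ‖(r / a) • (x - y) + (r / a - r / b) • y‖ := by
        congr 1
        simp only [radialRetraction, a, b]
        module
    _ ≤ 1 * ‖x - y‖ + ‖x - y‖ := by
        refine norm_add_le_of_le ?_ (by rwa [norm_smul, Real.norm_eq_abs])
        rw [norm_smul, Real.norm_of_nonneg (by positivity)]
        gcongr
        exact (div_le_one ha).2 (le_max_left _ _)
    _ = ‖x - y‖ + ‖x - y‖ := by rw [one_mul]

theorem exists_hasDerivWithinAt_of_lipschitzWith [CompleteSpace E] {Y : E → E} {L K : NNReal}
    (hK : LipschitzWith K Y) (hL : ∀ z, ‖Y z‖ ≤ L) {τ : ℝ} (hτ : 0 ≤ τ) (z₀ : E) :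
    ∃ y : ℝ → E, y 0 = z₀ ∧ ∀ t ∈ Icc (-τ) τ, HasDerivWithinAt y (Y (y t)) (Icc (-τ) τ) t := by
  have hPL : IsPicardLindelof (fun _ => Y) (tmin := -τ) (tmax := τ)
      ⟨0, neg_nonpos.2 hτ, hτ⟩ z₀ (L * τ.toNNReal) 0 L K :=
    .of_time_independent (fun z _ => hL z) hK.lipschitzOnWith
      (by simp [Real.coe_toNNReal _ hτ])
  exact hPL.exists_eq_forall_mem_Icc_hasDerivWithinAt₀

end RadialRetraction

namespace OscillatorSpace

variable {E : Type*} [NormedAddCommGroup E] [NormedSpace ℂ E] {S : OscillatorSpace E}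

theorem IsHamiltonian.lipschitzOnWith_field {H : E → ℂ} {r M s : ℝ} (hH : S.IsHamiltonian r M H)
    (hs : 0 < s) :
    LipschitzOnWith (2 * M / s).toNNReal (fun z => S.J (fderiv ℂ H z)) (ball 0 (r - s)) := by
  refine LipschitzOnWith.of_dist_le_mul fun x hx y hy => ?_
  have hsub : ball (0 : E) (r - s) ⊆ ball 0 r := ball_subset_ball (by linarith)
  have hM := hH.bound_nonneg (hsub hx)
  rw [dist_eq_norm, dist_eq_norm, Real.coe_toNNReal _ (by positivity)]
  exact (convex_ball (0 : E) _).norm_image_sub_le_of_norm_fderiv_le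
    (fun z hz => hH.differentiableOn_field.differentiableAt (isOpen_ball.mem_nhds (hsub hz)))
    (fun z hz => norm_fderiv_le hs hH.differentiableOn_field (fun _ => hH.norm_field_le) hz) hy hx

variable [NormedSpace ℝ E]

variable (S) in
theorem c_eq_of_hasDerivWithinAt {Y : E → E} (hK : ∀ r, ∃ K, LipschitzOnWith K Y (ball 0 r))
    (hY : ∀ z, Y (S.c z) = S.c (Y z)) {τ : ℝ} (hτ : 0 < τ) {y : ℝ → E}
    (hy : ∀ t ∈ Icc (-τ) τ, HasDerivWithinAt y (Y (y t)) (Icc (-τ) τ) t)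
    (h0 : S.c (y 0) = y 0) : ∀ t ∈ Icc (-τ) τ, S.c (y t) = y t := by
  have hcont : ContinuousOn y (Icc (-τ) τ) := fun t ht => (hy t ht).continuousWithinAt
  obtain ⟨r, hr⟩ := (isCompact_Icc.image_of_continuousOn hcont).isBounded.subset_ball 0
  obtain ⟨K, hK⟩ := hK r
  have hyr : ∀ t ∈ Ioo (-τ) τ, y t ∈ ball 0 r := fun t ht =>
    hr (mem_image_of_mem y (Ioo_subset_Icc_self ht))
  have hderiv : ∀ t ∈ Ioo (-τ) τ, HasDerivAt y (Y (y t)) t := fun t ht =>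
    (hy t (Ioo_subset_Icc_self ht)).hasDerivAt (Icc_mem_nhds ht.1 ht.2)
  have hderiv_c : ∀ t ∈ Ioo (-τ) τ, HasDerivAt (fun t => S.c (y t)) (Y (S.c (y t))) t :=
    fun t ht => by
      rw [hY]
      exact ((S.c : E →+ E).toRealLinearMap S.c.continuous).hasFDerivAt.comp_hasDerivAt t
        (hderiv t ht)
  exact ODE_solution_unique_of_mem_Icc (v := fun _ => Y) (s := fun _ => ball 0 r)
    (fun _ _ => hK) ⟨neg_lt_zero.2 hτ, hτ⟩ (S.c.continuous.comp_continuousOn hcont) hderiv_c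
    (fun t ht => c_mem_ball (hyr t ht)) hcont hderiv hyr h0

theorem isRealOrbitIn_of_hasDerivWithinAt {H : E → ℂ} (hH : ∀ r, ∃ M, S.IsHamiltonian r M H)
    {τ : ℝ} (hτ : 0 < τ) {y : ℝ → E}
    (hy : ∀ t ∈ Icc (-τ) τ, HasDerivWithinAt y (S.J (fderiv ℂ H (y t))) (Icc (-τ) τ) t)
    (h0 : S.c (y 0) = y 0) (U : Set E) : S.IsRealOrbitIn H U τ y := by
  refine ⟨fun t ht => (hy t ht).continuousWithinAt,
    c_eq_of_hasDerivWithinAt S (Y := fun z => S.J (fderiv ℂ H z)) (fun r => ?_)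
    (fun z => ?_) hτ hy h0, fun t ht _ => hy t ht⟩
  · obtain ⟨M, hM⟩ := hH (r + 1)
    exact ⟨_, add_sub_cancel_right r 1 ▸ hM.lipschitzOnWith_field one_pos⟩
  · obtain ⟨M, hM⟩ := hH (‖z‖ + 1)
    exact hM.field_conj (by simp)

theorem exists_isRealOrbitIn_ball [CompleteSpace E] {H : E → ℂ} {r ρ M τ : ℝ}
    (hH : S.IsHamiltonian ρ M H) (hr : 0 < r) (hrρ : r < ρ) (hτ : 0 < τ) {z₀ : E}
    (hz₀ : S.c z₀ = z₀) : ∃ y : ℝ → E, y 0 = z₀ ∧ S.IsRealOrbitIn H (ball 0 r) τ y := by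
  let Y : E → E := fun z => S.J (fderiv ℂ H (radialRetraction r z))
  have hretract : ∀ z : E, radialRetraction r z ∈ ball 0 (ρ - (ρ - r) / 2) := fun z => by
    rw [mem_ball_zero_iff]
    linarith [norm_radialRetraction_le hr z]
  have hretract' : ∀ z : E, radialRetraction r z ∈ ball 0 ρ := fun z =>
    ball_subset_ball (by linarith) (hretract z)
  have hY : LipschitzWith _ Y := lipschitzOnWith_univ.1
    ((hH.lipschitzOnWith_field (half_pos (sub_pos.2 hrρ))).comp
      (lipschitzWith_radialRetraction hr).lipschitzOnWith fun z _ => hretract z)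
  have hYM : ∀ z, ‖Y z‖ ≤ M.toNNReal := fun z =>
    (hH.norm_field_le (hretract' z)).trans (Real.le_coe_toNNReal M)
  have hYc : ∀ z, Y (S.c z) = S.c (Y z) := fun z => by
    rw [← hH.field_conj (hretract' z), radialRetraction, map_real_smul S.c S.c.continuous,
      ← S.norm_c z]
    rfl
  obtain ⟨y, hy0, hy⟩ := exists_hasDerivWithinAt_of_lipschitzWith hY hYM hτ.le z₀
  refine ⟨y, hy0, fun t ht => (hy t ht).continuousWithinAt, c_eq_of_hasDerivWithinAt S
    (fun _ => ⟨_, hY.lipschitzOnWith⟩) hYc hτ hy (by rw [hy0, hz₀]), fun t ht hyt => ?_⟩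
  simpa only [Y, radialRetraction_of_norm_le hr (mem_ball_zero_iff.1 hyt).le] using hy t ht

end OscillatorSpace

end HolomorphicNormalForm

namespace KleinGordon

open Metric ComplexConjugate HolomorphicNormalForm OscillatorSpace

/-! ### Square-summable families -/

/-- Square-summable complex families indexed by `α`; `Ell2 (Fin d → ℤ)` is `Seq d`. -/
abbrev Ell2 (α : Type*) : Type _ := lp (fun _ : α => ℂ) 2

namespace Ell2

section Pointwise

variable {α : Type*}

/-- The bilinear pairing `∑ x_j y_j`. -/
def pair : Ell2 α →L[ℂ] Ell2 α →L[ℂ] ℂ :=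
  lp.dualPairing 2 2 (K := 1) (fun _ => ContinuousLinearMap.mul ℂ ℂ) fun _ => by simp

theorem pair_apply (x y : Ell2 α) : pair x y = ∑' j, x j * y j := rfl

theorem pair_eq_inner (x y : Ell2 α) : pair x y = inner ℂ (star x) y := by
  rw [pair_apply, lp.inner_eq_tsum]
  exact tsum_congr fun j => by simp [mul_comm]

theorem summable_pair (x y : Ell2 α) : Summable fun j => x j * y j :=
  (lp.summable_inner (𝕜 := ℂ) (star x) y).congr fun j => by simp [mul_comm]

theorem norm_pair_le (x y : Ell2 α) : ‖pair x y‖ ≤ ‖x‖ * ‖y‖ := by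
  rw [pair_eq_inner, ← norm_star x]
  exact norm_inner_le_norm (star x) y

theorem pair_comm (x y : Ell2 α) : pair x y = pair y x := by
  simp only [pair_apply, mul_comm]

theorem pair_star (x y : Ell2 α) : pair (star x) (star y) = conj (pair x y) := by
  simp [pair_apply, Complex.conj_tsum]

theorem inner_star_right (x y : Ell2 α) : inner ℂ x (star y) = conj (inner ℂ (star x) y) := by
  rw [← pair_eq_inner, ← pair_star, pair_eq_inner, star_star]

theorem pair_self_of_star_eq {x : Ell2 α} (hx : star x = x) :
    pair x x = ((‖x‖ ^ 2 : ℝ) : ℂ) := by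
  rw [pair_eq_inner, hx, inner_self_eq_norm_sq_to_K]
  norm_cast

theorem norm_mul_le (x y : Ell2 α) (j : α) : ‖x j * y j‖ ≤ ‖((‖x‖ : ℂ) • y) j‖ := by
  rw [norm_mul, lp.coeFn_smul, Pi.smul_apply, norm_smul, Complex.norm_real, norm_norm]
  gcongr
  exact lp.norm_apply_le_norm two_ne_zero x j

theorem memℓp_mul (x y : Ell2 α) : Memℓp (fun j => x j * y j) 2 :=
  (lp.memℓp ((‖x‖ : ℂ) • y)).mono' (norm_mul_le x y)

theorem norm_le_of_eq_mul {x y z : Ell2 α} (h : ∀ j, z j = x j * y j) : ‖z‖ ≤ ‖x‖ * ‖y‖ := by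
  rw [← norm_norm x, ← Complex.norm_real, ← norm_smul]
  exact lp.norm_mono two_ne_zero fun j => by rw [h]; exact norm_mul_le x y j

/-- The pointwise product, which is square summable since each factor is bounded. -/
def pointwiseMul : Ell2 α →L[ℂ] Ell2 α →L[ℂ] Ell2 α :=
  (LinearMap.mk₂ ℂ
    (fun x y : Ell2 α => (⟨fun j => x j * y j, memℓp_mul x y⟩ : Ell2 α))
    (fun x x' y => by ext j; exact add_mul _ _ _) (fun a x y => by ext j; simp [mul_assoc])
    (fun x y y' => by ext j; exact mul_add _ _ _)
    (fun a x y => by ext j; simp [mul_left_comm])).mkContinuous₂ 1 fun x y => by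
      rw [one_mul]
      exact norm_le_of_eq_mul (x := x) (y := y) fun _ => rfl

theorem pointwiseMul_apply (x y : Ell2 α) (j : α) : pointwiseMul x y j = x j * y j := rfl

/-- The pointwise power `x_j ^ (n + 1)`. -/
def powSucc : ℕ → Ell2 α → Ell2 α
  | 0, x => x
  | n + 1, x => pointwiseMul (powSucc n x) x

theorem powSucc_apply (n : ℕ) (x : Ell2 α) (j : α) : powSucc n x j = x j ^ (n + 1) := by
  induction n with
  | zero => rw [powSucc, zero_add, pow_one]
  | succ n ih => rw [powSucc, pointwiseMul_apply, ih, pow_succ _ (n + 1)]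

theorem norm_powSucc_le (n : ℕ) (x : Ell2 α) : ‖powSucc n x‖ ≤ ‖x‖ ^ (n + 1) := by
  induction n with
  | zero => rw [powSucc, zero_add, pow_one]
  | succ n ih =>
    rw [powSucc, pow_succ]
    exact (norm_le_of_eq_mul (pointwiseMul_apply _ x)).trans (by gcongr)

theorem powSucc_star (n : ℕ) (x : Ell2 α) : powSucc n (star x) = star (powSucc n x) := by
  ext j
  simp [powSucc_apply]

theorem hasFDerivAt_powSucc_succ (n : ℕ) (x : Ell2 α) :
    HasFDerivAt (powSucc (n + 1)) ((n + 2 : ℂ) • pointwiseMul (powSucc n x)) x := by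
  induction n with
  | zero =>
    refine (pointwiseMul.hasFDerivAt.clm_apply (hasFDerivAt_id x)).congr_fderiv ?_
    ext h j
    simp [powSucc, pointwiseMul_apply, mul_comm (h j), two_mul]
  | succ n ih =>
    refine ((pointwiseMul.hasFDerivAt.comp x ih).clm_apply (hasFDerivAt_id x)).congr_fderiv ?_
    ext h j
    simp only [powSucc, add_apply, ContinuousLinearMap.comp_apply,
      ContinuousLinearMap.flip_apply, smul_apply, ContinuousLinearMap.id_apply,
      id_eq, Function.comp_apply, lp.coeFn_add, lp.coeFn_smul, Pi.add_apply, Pi.smul_apply,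
      pointwiseMul_apply, smul_eq_mul]
    push_cast
    ring

theorem hasFDerivAt_pair_powSucc (n : ℕ) (x : Ell2 α) :
    HasFDerivAt (fun x : Ell2 α => pair (powSucc n x) x)
      ((n + 2 : ℂ) • pair (powSucc n x)) x := by
  rcases n with _ | n
  · simpa [powSucc] using hasFDerivAt_bilinear_self pair_comm x
  have hpow := (pair.hasFDerivAt.comp x (hasFDerivAt_powSucc_succ n x)).clm_apply
    (hasFDerivAt_id x)
  refine hpow.congr_fderiv ?_
  ext h
  have hassoc : pair (pointwiseMul (powSucc n x) h) x = pair (powSucc (n + 1) x) h := by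
    simp only [pair_apply, powSucc, pointwiseMul_apply, mul_right_comm]
  simp [hassoc]
  ring

theorem pair_powSucc_self_of_star_eq {x : Ell2 α} (hx : star x = x) (n : ℕ) :
    pair (powSucc (2 * n) x) x = ((‖powSucc n x‖ ^ 2 : ℝ) : ℂ) := by
  rw [← pair_self_of_star_eq (by rw [← powSucc_star, hx]), pair_apply, pair_apply]
  refine tsum_congr fun j => ?_
  rw [powSucc_apply, powSucc_apply]
  ring

end Pointwise

section Translation

variable {Λ : Type*} [AddGroup Λ]

/-- The translate `x_{j+k}` of a family indexed by a group. -/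
def translate (k : Λ) : Ell2 Λ →ₗᵢ[ℂ] Ell2 Λ where
  toFun x := ⟨fun j => x (j + k), (memℓp_gen_iff (by norm_num)).2
    (((memℓp_gen_iff (by norm_num)).1 (lp.memℓp x)).comp_injective (add_left_injective k))⟩
  map_add' _ _ := rfl
  map_smul' a x := by ext j; simp
  norm_map' x := by
    simp only [lp.norm_eq_tsum_rpow (p := 2) (by norm_num)]
    exact congrArg (· ^ _) ((Equiv.addRight k).tsum_eq fun j => ‖x j‖ ^ _)

/-- The differences `x_j - x_{j+k}`. -/
def diff (k : Λ) : Ell2 Λ →L[ℂ] Ell2 Λ :=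
  ContinuousLinearMap.id ℂ _ - (translate k).toContinuousLinearMap

theorem diff_apply (k : Λ) (x : Ell2 Λ) (j : Λ) : diff k x j = x j - x (j + k) := rfl

theorem norm_diff_le (k : Λ) (x : Ell2 Λ) : ‖diff k x‖ ≤ 2 * ‖x‖ := by
  rw [two_mul]
  exact norm_sub_le_of_le le_rfl ((translate k).norm_map x).le

theorem diff_star (k : Λ) (x : Ell2 Λ) : diff k (star x) = star (diff k x) := by
  ext j
  simp [diff_apply]

/-- The quadratic energy `∑ (x_j - x_{j+k})²` of the bonds in the direction `k`, polarized. -/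
def bondForm (k : Λ) : Ell2 Λ →L[ℂ] Ell2 Λ →L[ℂ] ℂ := pair.bilinearComp (diff k) (diff k)

theorem bondForm_apply (k : Λ) (x y : Ell2 Λ) :
    bondForm k x y = pair (diff k x) (diff k y) := rfl

theorem bondForm_comm (k : Λ) (x y : Ell2 Λ) : bondForm k x y = bondForm k y x := pair_comm _ _

theorem norm_bondForm_le (k : Λ) (x : Ell2 Λ) : ‖bondForm k x‖ ≤ 4 * ‖x‖ := by
  refine ContinuousLinearMap.opNorm_le_bound _ (by positivity) fun y => ?_
  calc ‖bondForm k x y‖ ≤ ‖diff k x‖ * ‖diff k y‖ := norm_pair_le _ _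
    _ ≤ (2 * ‖x‖) * (2 * ‖y‖) :=
        mul_le_mul (norm_diff_le k x) (norm_diff_le k y) (norm_nonneg _) (by positivity)
    _ = 4 * ‖x‖ * ‖y‖ := by ring

theorem bondForm_star (k : Λ) (x y : Ell2 Λ) :
    bondForm k (star x) (star y) = conj (bondForm k x y) := by
  rw [bondForm_apply, diff_star, diff_star, pair_star, bondForm_apply]

theorem bondForm_self_of_star_eq {x : Ell2 Λ} (hx : star x = x) (k : Λ) :
    bondForm k x x = ((‖diff k x‖ ^ 2 : ℝ) : ℂ) :=
  pair_self_of_star_eq (x := diff k x) (by rw [← diff_star, hx])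

theorem tsum_sub_sq (k : Λ) (x : Ell2 Λ) : ∑' j, (x j - x (j + k)) ^ 2 = bondForm k x x := by
  simp only [bondForm_apply, pair_apply, diff_apply, sq]

theorem summable_sub_sq (k : Λ) (x : Ell2 Λ) : Summable fun j => (x j - x (j + k)) ^ 2 := by
  simpa only [diff_apply, sq] using summable_pair (diff k x) (diff k x)

end Translation

end Ell2

/-! ### The lattice phase space -/

variable {d : ℕ}

theorem phase_ext {z w : Phase d} (h₁ : z.fst = w.fst) (h₂ : z.snd = w.snd) : z = w :=
  WithLp.ofLp_injective 2 (Prod.ext h₁ h₂)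

/-- The symplectic form `sympl` as a continuous bilinear map. -/
def symplForm : Phase d →L[ℂ] Phase d →L[ℂ] ℂ :=
  Ell2.pair.bilinearComp (WithLp.fstL 2 ℂ _ _) (WithLp.sndL 2 ℂ _ _)
    - Ell2.pair.bilinearComp (WithLp.sndL 2 ℂ _ _) (WithLp.fstL 2 ℂ _ _)

theorem symplForm_apply (z w : Phase d) :
    symplForm z w = Ell2.pair z.fst w.snd - Ell2.pair z.snd w.fst := rfl

theorem sympl_eq_symplForm (z w : Phase d) : sympl z w = symplForm z w :=
  (Ell2.summable_pair z.fst w.snd).tsum_sub (Ell2.summable_pair z.snd w.fst)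

/-- Complex conjugation of all coordinates. -/
def conjugation : Phase d →L⋆[ℂ] Phase d :=
  LinearMap.mkContinuous
    { toFun := fun z => WithLp.toLp 2 (star z.fst, star z.snd)
      map_add' := fun z w => phase_ext (by simp) (by simp)
      map_smul' := fun a z => phase_ext (by simp [star_smul]) (by simp [star_smul]) } 1 fun z => by
    refine le_of_sq_le_sq ?_ (by positivity)
    rw [one_mul, WithLp.prod_norm_sq_eq_of_L2, WithLp.prod_norm_sq_eq_of_L2]
    simp

theorem conjugation_fst (z : Phase d) : (conjugation z).fst = star z.fst := rfl

theorem conjugation_snd (z : Phase d) : (conjugation z).snd = star z.snd := rfl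

theorem conjugation_eq_iff (z : Phase d) : conjugation z = z ↔ IsReal z := by
  constructor
  · intro h j
    have hfst := congrArg (fun w : Phase d => w.fst j) h
    have hsnd := congrArg (fun w : Phase d => w.snd j) h
    exact ⟨Complex.conj_eq_iff_im.1 hfst, Complex.conj_eq_iff_im.1 hsnd⟩
  · intro h
    refine phase_ext ?_ ?_ <;> ext j
    · exact Complex.conj_eq_iff_im.2 (h j).1
    · exact Complex.conj_eq_iff_im.2 (h j).2

theorem norm_conjugation (z : Phase d) : ‖conjugation z‖ = ‖z‖ := by
  rw [← sq_eq_sq₀ (norm_nonneg _) (norm_nonneg _), WithLp.prod_norm_sq_eq_of_L2,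
    WithLp.prod_norm_sq_eq_of_L2, conjugation_fst, conjugation_snd, norm_star, norm_star]

theorem inner_conjugation_right (z w : Phase d) :
    inner ℂ z (conjugation w) = conj (inner ℂ (conjugation z) w) := by
  rw [WithLp.prod_inner_apply, WithLp.prod_inner_apply, map_add]
  exact congrArg₂ (· + ·) (Ell2.inner_star_right _ _) (Ell2.inner_star_right _ _)

/-- The Hamiltonian vector field `(v, -u)` of the harmonic oscillators `G`. -/
def oscField : Phase d →L[ℂ] Phase d :=
  (WithLp.prodContinuousLinearEquiv 2 ℂ (Seq d) (Seq d)).symm.toContinuousLinearMap.comp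
    ((WithLp.sndL 2 ℂ _ _).prod (-WithLp.fstL 2 ℂ _ _))

theorem oscField_fst (z : Phase d) : (oscField z).fst = z.snd := rfl

theorem oscField_snd (z : Phase d) : (oscField z).snd = -z.fst := rfl

theorem norm_oscField (z : Phase d) : ‖oscField z‖ = ‖z‖ := by
  rw [← sq_eq_sq₀ (norm_nonneg _) (norm_nonneg _), WithLp.prod_norm_sq_eq_of_L2,
    WithLp.prod_norm_sq_eq_of_L2, oscField_fst, oscField_snd, norm_neg, add_comm]

theorem oscField_conjugation (z : Phase d) : oscField (conjugation z) = conjugation (oscField z) :=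
  phase_ext rfl (star_neg _).symm

theorem symplForm_oscField_conjugation (z w : Phase d) :
    symplForm (oscField (conjugation z)) w = inner ℂ z w := by
  rw [symplForm_apply, oscField_fst, oscField_snd, conjugation_fst, conjugation_snd, map_neg,
    neg_apply, sub_neg_eq_add, Ell2.pair_eq_inner, Ell2.pair_eq_inner, star_star, star_star,
    add_comm]
  exact (WithLp.prod_inner_apply z w).symm

theorem norm_sq_add_norm_sq_rotation {V : Type*} [NormedAddCommGroup V] [InnerProductSpace ℂ V]
    (a b : ℝ) (u v : V) :
    ‖(a : ℂ) • u + (b : ℂ) • v‖ ^ 2 + ‖(a : ℂ) • v - (b : ℂ) • u‖ ^ 2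
      = (a ^ 2 + b ^ 2) * (‖u‖ ^ 2 + ‖v‖ ^ 2) := by
  have hre : (inner ℂ v u).re = (inner ℂ u v).re := inner_re_symm (𝕜 := ℂ) v u
  simp only [norm_add_sq (𝕜 := ℂ), norm_sub_sq (𝕜 := ℂ), norm_smul, inner_smul_left,
    inner_smul_right, Complex.conj_ofReal, Complex.norm_real, mul_pow, Real.norm_eq_abs, sq_abs,
    RCLike.re_eq_complex_re, Complex.re_ofReal_mul, hre]
  ring

theorem norm_rotation (t : ℝ) (z : Phase d) :
    ‖(Real.cos t : ℂ) • z + (Real.sin t : ℂ) • oscField z‖ = ‖z‖ := by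
  rw [← sq_eq_sq₀ (norm_nonneg _) (norm_nonneg _), WithLp.prod_norm_sq_eq_of_L2,
    WithLp.prod_norm_sq_eq_of_L2]
  have hrot := norm_sq_add_norm_sq_rotation (Real.cos t) (Real.sin t) z.fst z.snd
  rw [Real.cos_sq_add_sin_sq, one_mul] at hrot
  simpa only [WithLp.add_fst, WithLp.add_snd, WithLp.smul_fst, WithLp.smul_snd, oscField_fst,
    oscField_snd, smul_neg, ← sub_eq_add_neg] using hrot

/-- The vector `X` with `symplForm X h = l h`, so that `hamField f z` is `hamVec (fderiv ℂ f z)`. -/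
def hamVec : (Phase d →L[ℂ] ℂ) →L[ℂ] Phase d :=
  oscField.comp (conjugation.comp
    (InnerProductSpace.toDual ℂ (Phase d)).symm.toContinuousLinearEquiv.toContinuousLinearMap)

theorem hamVec_apply (l : Phase d →L[ℂ] ℂ) :
    hamVec l = oscField (conjugation ((InnerProductSpace.toDual ℂ (Phase d)).symm l)) := rfl

theorem hamField_eq_hamVec (f : Phase d → ℂ) (z : Phase d) :
    hamField f z = hamVec (fderiv ℂ f z) := rfl

theorem norm_hamVec (l : Phase d →L[ℂ] ℂ) : ‖hamVec l‖ = ‖l‖ := by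
  rw [hamVec_apply, norm_oscField, norm_conjugation, LinearIsometryEquiv.norm_map]

theorem hamVec_of_forall_apply_eq_conj {l l' : Phase d →L[ℂ] ℂ}
    (h : ∀ z, l' z = conj (l (conjugation z))) : hamVec l' = conjugation (hamVec l) := by
  have hriesz : (InnerProductSpace.toDual ℂ (Phase d)).symm l'
      = conjugation ((InnerProductSpace.toDual ℂ (Phase d)).symm l) := by
    rw [LinearIsometryEquiv.symm_apply_eq]
    ext z
    rw [h, InnerProductSpace.toDual_apply_apply, ← InnerProductSpace.toDual_symm_apply (y := l),
      inner_conjugation_right, Complex.conj_conj]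
  rw [hamVec_apply, hamVec_apply, hriesz, ← oscField_conjugation]

/-- The phase space of the Klein-Gordon lattice with its harmonic oscillators. -/
def phaseSpace (d : ℕ) : OscillatorSpace (Phase d) where
  ω := symplForm
  J := hamVec
  A := oscField
  c := conjugation
  ω_antisymm z w := by
    rw [symplForm_apply, symplForm_apply, Ell2.pair_comm z.fst, Ell2.pair_comm z.snd, neg_sub]
  ω_J l z := by
    rw [hamVec_apply, symplForm_oscField_conjugation, InnerProductSpace.toDual_symm_apply]
  norm_J l := (norm_hamVec l).le
  J_conj _ _ h := hamVec_of_forall_apply_eq_conj h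
  ω_c z w := by
    simp only [symplForm_apply, conjugation_fst, conjugation_snd, Ell2.pair_star, map_sub]
  A_A _ := rfl
  ω_A z w := by
    simp only [symplForm_apply, oscField_fst, oscField_snd, map_neg, neg_apply,
      Ell2.pair_comm z.snd, Ell2.pair_comm z.fst]
  norm_rot := norm_rotation
  c_c z := phase_ext (star_star _) (star_star _)
  norm_c := norm_conjugation
  A_c := oscField_conjugation
  ω_A_self z hz := by
    have hω := symplForm_oscField_conjugation z z
    rw [hz, inner_self_eq_norm_sq_to_K] at hω
    exact_mod_cast hω

theorem G_eq_energy : (G : Phase d → ℂ) = (phaseSpace d).energy := by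
  ext z
  have henergy : (phaseSpace d).energy z
      = (Ell2.pair z.snd z.snd - Ell2.pair (-z.fst) z.fst) / 2 := rfl
  rw [henergy, map_neg, neg_apply, sub_neg_eq_add, add_comm, Ell2.pair_apply, Ell2.pair_apply,
    ← (Ell2.summable_pair _ _).tsum_add (Ell2.summable_pair _ _), G, one_div_mul_eq_div]
  simp only [posCoord, momCoord, sq]

/-! ### The Klein-Gordon interaction -/

/-- The nearest-neighbour coupling `∑_j ∑_{|j-h|=1} (x_j - x_h)²`, polarized. -/
def coupling : Seq d →L[ℂ] Seq d →L[ℂ] ℂ :=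
  ∑ i, (Ell2.bondForm (unitVec i) + Ell2.bondForm (-unitVec i))

theorem coupling_apply (x y : Seq d) :
    coupling x y = ∑ i, (Ell2.bondForm (unitVec i) x y + Ell2.bondForm (-unitVec i) x y) := by
  simp [coupling]

theorem coupling_comm (x y : Seq d) : coupling x y = coupling y x := by
  simp only [coupling_apply, Ell2.bondForm_comm _ x]

theorem norm_coupling_le (x : Seq d) : ‖coupling x‖ ≤ 8 * d * ‖x‖ := by
  have hbond : ∀ i : Fin d,
      ‖Ell2.bondForm (unitVec i) x + Ell2.bondForm (-unitVec i) x‖ ≤ 8 * ‖x‖ := fun i =>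
    (norm_add_le_of_le (Ell2.norm_bondForm_le _ x) (Ell2.norm_bondForm_le _ x)).trans_eq (by ring)
  have hsum := norm_sum_le_of_le Finset.univ fun i _ => hbond i
  simpa [coupling, mul_left_comm, mul_assoc] using hsum

theorem tsum_sum_sub_sq (x : Seq d) :
    ∑' j, ∑ i : Fin d, ((x j - x (j + unitVec i)) ^ 2 + (x j - x (j - unitVec i)) ^ 2)
      = coupling x x := by
  simp only [sub_eq_add_neg _ (unitVec _)]
  rw [Summable.tsum_finsetSum fun i _ =>
    (Ell2.summable_sub_sq _ x).add (Ell2.summable_sub_sq _ x), coupling_apply]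
  refine Finset.sum_congr rfl fun i _ => ?_
  rw [(Ell2.summable_sub_sq _ x).tsum_add (Ell2.summable_sub_sq _ x), Ell2.tsum_sub_sq,
    Ell2.tsum_sub_sq]

theorem norm_sub_sq_le_coupling (hd : 1 ≤ d) {x : Seq d} (hx : star x = x) :
    ‖x 0 - x (0 + unitVec ⟨0, hd⟩)‖ ^ 2 ≤ (coupling x x).re := by
  have hbond : ∀ i : Fin d, (Ell2.bondForm (unitVec i) x x + Ell2.bondForm (-unitVec i) x x).re
      = ‖Ell2.diff (unitVec i) x‖ ^ 2 + ‖Ell2.diff (-unitVec i) x‖ ^ 2 := fun i => by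
    rw [Ell2.bondForm_self_of_star_eq hx, Ell2.bondForm_self_of_star_eq hx, Complex.add_re,
      Complex.ofReal_re, Complex.ofReal_re]
  rw [coupling_apply, Complex.re_sum, Finset.sum_congr rfl fun i _ => hbond i]
  calc ‖x 0 - x (0 + unitVec ⟨0, hd⟩)‖ ^ 2 ≤ ‖Ell2.diff (unitVec ⟨0, hd⟩) x‖ ^ 2 := by
        gcongr
        exact lp.norm_apply_le_norm two_ne_zero (Ell2.diff (unitVec ⟨0, hd⟩) x) 0
    _ ≤ ‖Ell2.diff (unitVec ⟨0, hd⟩) x‖ ^ 2 + ‖Ell2.diff (-unitVec ⟨0, hd⟩) x‖ ^ 2 :=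
        le_add_of_nonneg_right (sq_nonneg _)
    _ ≤ _ := Finset.single_le_sum
        (f := fun i => ‖Ell2.diff (unitVec i) x‖ ^ 2 + ‖Ell2.diff (-unitVec i) x‖ ^ 2)
        (fun i _ => by positivity) (Finset.mem_univ _)

/-- The perturbation `F` as a function of the positions. -/
def interaction (p : ℕ) (ε : ℝ) (x : Seq d) : ℂ :=
  (ε : ℂ) / (2 * (p : ℂ) + 2) * Ell2.pair (Ell2.powSucc (2 * p) x) x + (ε : ℂ) / 2 * coupling x x

theorem F_eq_interaction (p : ℕ) (ε : ℝ) (z : Phase d) : F p ε z = interaction p ε z.fst := by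
  rw [interaction, ← tsum_sum_sub_sq, Ell2.pair_apply]
  simp only [Ell2.powSucc_apply, ← pow_succ]
  rfl

/-- The differential of `interaction`. -/
def interactionDeriv (p : ℕ) (ε : ℝ) (x : Seq d) : Seq d →L[ℂ] ℂ :=
  (ε : ℂ) • (Ell2.pair (Ell2.powSucc (2 * p) x) + coupling x)

theorem hasFDerivAt_interaction (p : ℕ) (ε : ℝ) (x : Seq d) :
    HasFDerivAt (interaction p ε) (interactionDeriv p ε x) x := by
  have hp : (2 * (p : ℂ) + 2) ≠ 0 := by exact_mod_cast (by positivity : 2 * p + 2 ≠ 0)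
  have hpow := (Ell2.hasFDerivAt_pair_powSucc (2 * p) x).const_mul ((ε : ℂ) / (2 * (p : ℂ) + 2))
  have hcoupling := (hasFDerivAt_bilinear_self coupling_comm x).const_mul ((ε : ℂ) / 2)
  refine (hpow.add hcoupling).congr_fderiv ?_
  push_cast
  rw [smul_smul, smul_smul, div_mul_cancel₀ _ hp, div_mul_cancel₀ _ two_ne_zero, ← smul_add,
    interactionDeriv]

theorem norm_interactionDeriv_le (p : ℕ) {ε : ℝ} (hε : 0 ≤ ε) (x : Seq d) :
    ‖interactionDeriv p ε x‖ ≤ ε * (‖x‖ ^ (2 * p + 1) + 8 * d * ‖x‖) := by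
  have hpow : ‖Ell2.pair (Ell2.powSucc (2 * p) x)‖ ≤ ‖x‖ ^ (2 * p + 1) :=
    ContinuousLinearMap.opNorm_le_bound _ (by positivity) fun y =>
      (Ell2.norm_pair_le _ y).trans (by gcongr; exact Ell2.norm_powSucc_le _ x)
  rw [interactionDeriv, norm_smul, Complex.norm_real, Real.norm_of_nonneg hε]
  gcongr
  exact norm_add_le_of_le hpow (norm_coupling_le x)

theorem interaction_star (p : ℕ) (ε : ℝ) (x : Seq d) :
    interaction p ε (star x) = conj (interaction p ε x) := by
  simp only [interaction, coupling_apply, Ell2.bondForm_star, Ell2.powSucc_star, Ell2.pair_star,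
    map_add, map_mul, map_div₀, map_sum, Complex.conj_ofReal, map_ofNat, map_natCast]

theorem le_re_interaction (hd : 1 ≤ d) (p : ℕ) {ε : ℝ} (hε : 0 ≤ ε) {x : Seq d}
    (hx : star x = x) :
    ε / 2 * ‖x 0 - x (0 + unitVec ⟨0, hd⟩)‖ ^ 2 ≤ (interaction p ε x).re := by
  have hre : (interaction p ε x).re
      = ε / (2 * p + 2) * ‖Ell2.powSucc p x‖ ^ 2 + ε / 2 * (coupling x x).re := by
    rw [interaction, Ell2.pair_powSucc_self_of_star_eq hx, Complex.add_re,
      ← Complex.re_ofReal_mul, ← Complex.ofReal_re (ε / (2 * p + 2) * ‖Ell2.powSucc p x‖ ^ 2)]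
    push_cast
    rfl
  rw [hre]
  exact le_add_of_nonneg_of_le (by positivity)
    (mul_le_mul_of_nonneg_left (norm_sub_sq_le_coupling hd hx) (by positivity))

theorem hasFDerivAt_F (p : ℕ) (ε : ℝ) (z : Phase d) :
    HasFDerivAt (F p ε) ((interactionDeriv p ε z.fst).comp (WithLp.fstL 2 ℂ _ _)) z := by
  rw [funext (F_eq_interaction p ε)]
  exact (hasFDerivAt_interaction p ε z.fst).comp z (WithLp.fstL 2 ℂ (Seq d) (Seq d)).hasFDerivAt

theorem isHamiltonian_F (p : ℕ) {ε : ℝ} (hε : 0 ≤ ε) {r : ℝ} (hr : 0 ≤ r) :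
    (phaseSpace d).IsHamiltonian r (ε * (r ^ (2 * p + 1) + 8 * d * r)) (F p ε) where
  holo z _ := (hasFDerivAt_F p ε z).differentiableAt.differentiableWithinAt
  bound z hz := by
    rw [(hasFDerivAt_F p ε z).fderiv]
    have hzr : ‖z.fst‖ ≤ r := (WithLp.norm_fst_le _ z).trans (mem_ball_zero_iff.1 hz).le
    have hderiv : ‖interactionDeriv p ε z.fst‖ ≤ ε * (r ^ (2 * p + 1) + 8 * d * r) :=
      (norm_interactionDeriv_le p hε z.fst).trans (by gcongr)
    refine ContinuousLinearMap.opNorm_le_bound _ (by positivity) fun h => ?_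
    exact (ContinuousLinearMap.le_of_opNorm_le _ hderiv _).trans
      (by gcongr; exact WithLp.norm_fst_le _ h)
  real z _ := by
    rw [F_eq_interaction, F_eq_interaction, ← interaction_star]
    rfl

/-- The constant `8d + 1`; on the unit ball, `‖dF z‖` is at most `ε * (8d + 1) * ‖z‖`. -/
def couplingBound (d : ℕ) : ℝ := 8 * d + 1

theorem one_le_couplingBound (d : ℕ) : 1 ≤ couplingBound d :=
  le_add_of_nonneg_left (by positivity)

theorem couplingBound_pos (d : ℕ) : 0 < couplingBound d :=
  zero_lt_one.trans_le (one_le_couplingBound d)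

theorem isHamiltonian_F_of_le_one (p : ℕ) {ε : ℝ} (hε : 0 ≤ ε) {R : ℝ} (hR : 0 ≤ R)
    (hR1 : R ≤ 1) : (phaseSpace d).IsHamiltonian R (ε * couplingBound d * R) (F p ε) := by
  refine (isHamiltonian_F p hε hR).mono le_rfl ?_
  have hpow : R ^ (2 * p + 1) ≤ R := pow_le_of_le_one hR hR1 (by lia)
  calc ε * (R ^ (2 * p + 1) + 8 * d * R) ≤ ε * (R + 8 * d * R) := by gcongr
    _ = ε * couplingBound d * R := by rw [couplingBound]; ring

theorem H_eq_energy_add (p : ℕ) (ε : ℝ) :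
    (H p ε : Phase d → ℂ) = fun z => (phaseSpace d).energy z + F p ε z := by
  rw [← G_eq_energy]
  rfl

theorem exists_isHamiltonian_H (p : ℕ) {ε : ℝ} (hε : 0 ≤ ε) (r : ℝ) :
    ∃ M, (phaseSpace d).IsHamiltonian r M (H p ε) := by
  rw [H_eq_energy_add]
  exact ⟨_, ((isHamiltonian_energy (phaseSpace d) |r|).add
    (isHamiltonian_F p hε (abs_nonneg r))).mono (le_abs_self r) le_rfl⟩

/-- The real phase point with position `r` at the origin of the lattice, at rest elsewhere. -/
def singleSite (d : ℕ) (r : ℝ) : Phase d := WithLp.toLp 2 (lp.single 2 0 (r : ℂ), 0)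

theorem conjugation_singleSite (r : ℝ) : conjugation (singleSite d r) = singleSite d r := by
  refine phase_ext ?_ (star_zero _)
  ext j
  rcases eq_or_ne j 0 with rfl | hj
  · simp [conjugation_fst, singleSite]
  · simp [conjugation_fst, singleSite, hj]

theorem norm_singleSite {r : ℝ} (hr : 0 ≤ r) : ‖singleSite d r‖ = r := by
  rw [singleSite, WithLp.norm_toLp_fst, lp.norm_single (by norm_num), Complex.norm_real,
    Real.norm_of_nonneg hr]

instance : Nontrivial (Phase d) :=
  ⟨singleSite d 1, 0, norm_ne_zero_iff.1 (by rw [norm_singleSite zero_le_one]; norm_num)⟩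

theorem ballRd_zero (R : ℝ) : ballRd d R 0 = ball 0 R := by rw [ballRd, sub_zero, mul_one]

theorem norm_le_toReal_supNorm {R M : ℝ} {g : Phase d → ℂ}
    (hg : (phaseSpace d).IsHamiltonian R M g) {z : Phase d} (hz : z ∈ ball 0 R) :
    ‖g z‖ ≤ (supNorm R 0 g).toReal := by
  rw [supNorm, ballRd_zero]
  have hfin : ⨆ w ∈ ball 0 R, ‖g w‖ₑ ≠ ⊤ := by
    refine ne_top_of_le_ne_top (ENNReal.ofReal_ne_top (r := ‖g 0‖ + M * R))
      (iSup₂_le fun w hw => ?_)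
    rw [← ofReal_norm]
    exact ENNReal.ofReal_le_ofReal (hg.norm_le hw)
  rw [← toReal_enorm]
  exact ENNReal.toReal_mono hfin (le_iSup₂ (f := fun w (_ : w ∈ ball 0 R) => ‖g w‖ₑ) z hz)

theorem singleSite_mem_ball {R : ℝ} (hR : 0 < R) : singleSite d (R / 2) ∈ ball 0 R := by
  rw [mem_ball_zero_iff, norm_singleSite (half_pos hR).le]
  exact half_lt_self hR

theorem sq_div_eight_le_supNorm_G {R : ℝ} (hR : 0 < R) :
    R ^ 2 / 8 ≤ (supNorm R 0 (G (d := d))).toReal := by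
  have h := norm_le_toReal_supNorm (isHamiltonian_energy (phaseSpace d) R)
    (singleSite_mem_ball hR)
  rw [energy_of_real (conjugation_singleSite _), norm_singleSite (half_pos hR).le,
    Complex.norm_real, Real.norm_of_nonneg (by positivity), ← G_eq_energy] at h
  linarith

theorem sq_div_eight_le_supNorm_F (hd : 1 ≤ d) (p : ℕ) {ε R : ℝ} (hε : 0 ≤ ε) (hR : 0 < R) :
    ε * R ^ 2 / 8 ≤ (supNorm R 0 (F (d := d) p ε)).toReal := by
  have hne : unitVec (⟨0, hd⟩ : Fin d) ≠ 0 := by simp [unitVec]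
  have hreal : star (singleSite d (R / 2)).fst = (singleSite d (R / 2)).fst :=
    congrArg WithLp.fst (conjugation_singleSite (d := d) (R / 2))
  have hbond : ‖(singleSite d (R / 2)).fst 0 - (singleSite d (R / 2)).fst
      (0 + unitVec ⟨0, hd⟩)‖ = R / 2 := by
    simp [singleSite, Pi.single_eq_of_ne hne, abs_of_pos hR]
  calc ε * R ^ 2 / 8 = ε / 2 * (R / 2) ^ 2 := by ring
    _ ≤ (F p ε (singleSite d (R / 2))).re := by
      have hF := le_re_interaction hd p hε hreal
      rwa [hbond, ← F_eq_interaction] at hF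
    _ ≤ ‖F p ε (singleSite d (R / 2))‖ := Complex.re_le_norm _
    _ ≤ _ := norm_le_toReal_supNorm (isHamiltonian_F p hε hR.le) (singleSite_mem_ball hR)

/-! ### Normal form and long orbits of the lattice -/

theorem exists_natCast_mul_le_and_pow_le_exp {δ κ μ : ℝ} (hκ : 0 < κ) (hκδ : 512 * κ ≤ δ)
    (hμ : 512 * κ / δ ≤ μ) :
    ∃ k : ℕ, k * (128 * κ) ≤ δ / 2 ∧ (4⁻¹ : ℝ) ^ k ≤ Real.exp (-(1 / μ)) := by
  have hδ : 0 < δ := by linarith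
  have hquotient : 2 ≤ δ / (256 * κ) := by
    rw [le_div_iff₀ (by positivity)]
    linarith
  refine ⟨⌊δ / (256 * κ)⌋₊, ?_, ?_⟩
  · have hfloor := Nat.floor_le (show 0 ≤ δ / (256 * κ) by positivity)
    rw [le_div_iff₀ (by positivity)] at hfloor
    linarith
  · have hinv : 1 / μ ≤ δ / (256 * κ) / 2 := by
      refine (one_div_le_one_div_of_le (by positivity) hμ).trans_eq ?_
      field_simp
      norm_num
    have hfloor : 1 / μ ≤ ⌊δ / (256 * κ)⌋₊ := by linarith [Nat.lt_floor_add_one (δ / (256 * κ))]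
    have hfour : (4⁻¹ : ℝ) ≤ Real.exp (-1) := by
      rw [Real.exp_neg]
      exact inv_anti₀ (Real.exp_pos 1) (by linarith [Real.exp_one_lt_d9])
    calc (4⁻¹ : ℝ) ^ ⌊δ / (256 * κ)⌋₊ ≤ Real.exp (-1) ^ ⌊δ / (256 * κ)⌋₊ := by gcongr
      _ = Real.exp (-⌊δ / (256 * κ)⌋₊) := by rw [← Real.exp_nat_mul, mul_neg_one]
      _ ≤ Real.exp (-(1 / μ)) := Real.exp_le_exp.2 (neg_le_neg hfloor)

theorem le_mu {K R δ ε : ℝ} (p : ℕ) (hK : 0 ≤ K) (hR : 0 ≤ R) (hδ : 0 < δ) (hε : 0 ≤ ε) :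
    512 * (ε * K) / δ ≤ mu (3 * K) R δ p ε := by
  have heπ : 8 ≤ Real.exp 1 * Real.pi := by
    have := mul_le_mul Real.exp_one_gt_d9.le Real.pi_gt_three.le (by norm_num) (Real.exp_pos 1).le
    linarith
  rw [mu]
  refine div_le_div_of_nonneg_right ?_ hδ.le
  calc 512 * (ε * K) ≤ 12 * 8 * (2 * ε * (3 * K)) := by linarith [mul_nonneg hε hK]
    _ ≤ 12 * (Real.exp 1 * Real.pi) * (2 * ε * (3 * K + R ^ (2 * p))) := by
        gcongr
        exact le_add_of_nonneg_right (by positivity)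
    _ = 12 * Real.exp 1 * Real.pi * (2 * ε * (3 * K + R ^ (2 * p))) := by ring

theorem mul_le_mu {K R δ ε : ℝ} (p : ℕ) (hK : 0 ≤ K) (hR : 0 ≤ R) (hδ : 0 < δ) (hδ4 : δ ≤ 1 / 4)
    (hε : 0 ≤ ε) : 2048 * (ε * K) ≤ mu (3 * K) R δ p ε :=
  calc 2048 * (ε * K) = 512 * (ε * K) / (1 / 4) := by ring
    _ ≤ 512 * (ε * K) / δ := by gcongr
    _ ≤ mu (3 * K) R δ p ε := le_mu p hK hR hδ hε

theorem fieldNorm_le {R δ B : ℝ} (hR : 0 < R) {g : Phase d → ℂ}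
    (hg : ∀ z ∈ ballRd d R δ, ‖fderiv ℂ g z‖ ≤ R * B) :
    fieldNorm R δ g ≤ ENNReal.ofReal B := by
  have hsup : ⨆ z ∈ ballRd d R δ, ‖hamField g z‖ₑ ≤ ENNReal.ofReal R * ENNReal.ofReal B := by
    rw [← ENNReal.ofReal_mul hR.le]
    refine iSup₂_le fun z hz => ?_
    rw [← ofReal_norm, hamField_eq_hamVec, norm_hamVec]
    exact ENNReal.ofReal_le_ofReal (hg z hz)
  have hR0 : ENNReal.ofReal R ≠ 0 := (ENNReal.ofReal_pos.2 hR).ne'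
  calc fieldNorm R δ g
      ≤ (ENNReal.ofReal R)⁻¹ * (ENNReal.ofReal R * ENNReal.ofReal B) := by
        rw [fieldNorm]
        gcongr
    _ = ENNReal.ofReal B := ENNReal.inv_mul_cancel_left hR0 ENNReal.ofReal_ne_top

theorem poisson_G_eq_zero {Z : Phase d → ℂ} {z : Phase d}
    (hZ : fderiv ℂ Z z ((phaseSpace d).A z) = 0) : poisson G Z z = 0 := by
  have hω := (phaseSpace d).ω_antisymm ((phaseSpace d).J (fderiv ℂ Z z)) ((phaseSpace d).A z)
  rw [(phaseSpace d).ω_J, hZ, zero_eq_neg] at hω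
  rw [poisson, G_eq_energy, (hasFDerivAt_energy z).fderiv]
  exact hω

theorem im_eq_zero_of_isReal {g : Phase d → ℂ} {r M : ℝ}
    (hg : (phaseSpace d).IsHamiltonian r M g) {z : Phase d} (hz : z ∈ ball 0 r) (hr : IsReal z) :
    (g z).im = 0 := by
  have hconj := hg.real z hz
  rw [show (phaseSpace d).c z = z from (conjugation_eq_iff z).2 hr] at hconj
  exact Complex.conj_eq_iff_im.1 hconj.symm

theorem isCanonical_T {F : Phase d → ℂ} {ρ r r' e b q : ℝ}
    {N : (phaseSpace d).NormalForm F ρ r e b q} {Ψ : OpenPartialHomeomorph (Phase d) (Phase d)}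
    (hΨ : N.IsChart r' Ψ) : IsCanonical N.T (ball 0 r) where
  holo := N.symplectic.holo
  isOpen_image := hΨ.image_T ▸ Ψ.open_target
  inverse := ⟨Ψ.symm, hΨ.image_T ▸ hΨ.holo_symm, fun z hz => by
    rw [← hΨ.apply_eq, Ψ.left_inv (hΨ.source_eq ▸ hz)]⟩
  symplectic z hz h k := by
    rw [sympl_eq_symplForm, sympl_eq_symplForm]
    exact N.symplectic.sympl z hz h k
  real z hz hr := by
    rw [← conjugation_eq_iff] at hr ⊢
    have hT := N.symplectic.real z hz
    rw [show (phaseSpace d).c z = z from hr] at hT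
    exact hT.symm

theorem exists_normalForm_isChart (p : ℕ) {R δ ε μ : ℝ} (hR : 0 < R) (hR1 : R ≤ 1) (hε : 0 < ε)
    (hδ : 512 * (ε * couplingBound d) ≤ δ) (hμ : 512 * (ε * couplingBound d) / δ ≤ μ) :
    ∃ (q : ℝ) (N : (phaseSpace d).NormalForm (F p ε) R (R * (1 - δ))
        (8 * (ε * couplingBound d) * R) (2 * (ε * couplingBound d) * R)
        (ε * couplingBound d * R * q)) (Ψ : _),
      N.IsChart (R * (1 - 3 / 2 * δ)) Ψ ∧ 0 ≤ q ∧ q ≤ Real.exp (-(1 / μ)) := by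
  have hκ := mul_pos hε (couplingBound_pos d)
  obtain ⟨k, hk, hkμ⟩ := exists_natCast_mul_le_and_pow_le_exp hκ hδ hμ
  obtain ⟨N, Ψ, hΨ⟩ := (isHamiltonian_F_of_le_one p hε.le hR.le hR1).exists_normalForm_isChart
    hR hκ (by linarith) hk
  exact ⟨_, N, Ψ, hΨ, by positivity, hkμ⟩

theorem IsOrbit.isRealOrbitIn {p : ℕ} {ε τ : ℝ} {z₀ : Phase d} {z : ℝ → Phase d}
    (hz : IsOrbit (H p ε) τ z₀ z) (hε : 0 ≤ ε) (hτ : 0 < τ) (hz₀ : IsReal z₀) (U : Set (Phase d)) :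
    (phaseSpace d).IsRealOrbitIn (fun w => (phaseSpace d).energy w + F p ε w) U τ z := by
  obtain ⟨rfl, hderiv⟩ := hz
  rw [← H_eq_energy_add]
  exact isRealOrbitIn_of_hasDerivWithinAt (exists_isHamiltonian_H p hε) hτ hderiv
    ((conjugation_eq_iff _).2 hz₀) U

theorem mul_exp_le_one_of_le_exp_neg {q x : ℝ} (hq : q ≤ Real.exp (-x)) : q * Real.exp x ≤ 1 := by
  rwa [← le_div_iff₀ (Real.exp_pos _), one_div, ← Real.exp_neg]

section NormalForm

variable {p : ℕ} {ε R δ κ q x : ℝ}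
  {N : (phaseSpace d).NormalForm (F p ε) R (R * (1 - δ)) (8 * κ * R) (2 * κ * R) (κ * R * q)}
  {Ψ : OpenPartialHomeomorph (Phase d) (Phase d)} {z₀ : Phase d}

variable (N) in
theorem fieldNorm_P_le {μ : ℝ} (hR : 0 < R) (hμ : 0 ≤ μ) (hκμ : κ ≤ μ) (hq : 0 ≤ q)
    (hqx : q ≤ Real.exp (-x)) :
    fieldNorm R δ N.P ≤ ENNReal.ofReal (μ * Real.exp (-x)) := by
  refine fieldNorm_le hR fun z hz => (N.P_hamiltonian.bound z hz).trans ?_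
  calc κ * R * q = R * (κ * q) := by ring
    _ ≤ R * (μ * Real.exp (-x)) := by gcongr

theorem exists_isOrbit (hΨ : N.IsChart (R * (1 - 3 / 2 * δ)) Ψ) (hε : 0 ≤ ε) (hR : 0 < R)
    (hδ : δ ≤ 1 / 4) (hκ : 0 ≤ κ) (hκδ : 80 * κ < δ) (hq : 0 ≤ q) (hqx : q ≤ Real.exp (-x))
    (hz₀ : z₀ ∈ ballRd d R (3 * δ)) (hreal : IsReal z₀) :
    ∃ z : ℝ → Phase d, IsOrbit (H p ε) (Real.exp x) z₀ z := by
  have hqτ := mul_exp_le_one_of_le_exp_neg hqx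
  have hRδ : 0 < R * δ := mul_pos hR (by linarith)
  have hr : 0 < R * (1 - 3 / 2 * δ) := mul_pos hR (by linarith)
  obtain ⟨M, hH⟩ := exists_isHamiltonian_H (d := d) p hε R
  obtain ⟨z, rfl, hz⟩ := exists_isRealOrbitIn_ball hH hr (by linarith) (Real.exp_pos x)
    ((conjugation_eq_iff z₀).2 hreal)
  refine ⟨z, rfl, fun t ht => hz.hasDerivWithinAt t ht ?_⟩
  rw [H_eq_energy_add] at hz
  exact hz.mem_ball hΨ (fun w _ => (hasFDerivAt_F p ε w).differentiableAt) hR hδ hκ hκδ hq hqτ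
    (mem_ball_zero_iff.1 hz₀) ht

theorem IsOrbit.mem_ballRd_and_norm_sub_le {z : ℝ → Phase d}
    (hz : IsOrbit (H p ε) (Real.exp x) z₀ z) (hΨ : N.IsChart (R * (1 - 3 / 2 * δ)) Ψ)
    (hε : 0 ≤ ε) (hR : 0 < R) (hδ : δ ≤ 1 / 4) (hκ : 0 ≤ κ) (hκδ : 80 * κ < δ) (hq : 0 ≤ q)
    (hqx : q ≤ Real.exp (-x)) (hz₀ : z₀ ∈ ballRd d R (3 * δ)) (hreal : IsReal z₀) {t : ℝ}
    (ht : t ∈ Icc (-Real.exp x) (Real.exp x)) :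
    z t ∈ ballRd d R δ ∧ ‖G (z t) - G z₀‖ ≤ 17 * κ * R ^ 2
      ∧ ‖N.Z (z t) - N.Z z₀‖ ≤ 34 * κ ^ 2 * R ^ 2 := by
  have hy := hz.isRealOrbitIn hε (Real.exp_pos x) hreal (ball 0 (R * (1 - 3 / 2 * δ)))
  have hF : ∀ w ∈ ball 0 (R * (1 - 3 / 2 * δ)), DifferentiableAt ℂ (F (d := d) p ε) w :=
    fun w _ => (hasFDerivAt_F p ε w).differentiableAt
  have hqτ := mul_exp_le_one_of_le_exp_neg hqx
  have hRδ : 0 < R * δ := mul_pos hR (by linarith)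
  obtain ⟨rfl, -⟩ := hz
  have hz₀' := mem_ball_zero_iff.1 hz₀
  rw [G_eq_energy]
  exact ⟨ball_subset_ball (by linarith) (hy.mem_ball hΨ hF hR hδ hκ hκδ hq hqτ hz₀' ht),
    hy.norm_energy_sub_le hΨ hF hR hδ hκ hκδ hq hqτ hz₀' ht,
    hy.norm_Z_sub_le hΨ hF hR hδ hκ hκδ hq hqτ hz₀' ht⟩

end NormalForm

theorem lt_mul_supNorm_G {K R κ μ : ℝ} (hK : 1 ≤ K) (hR : 0 < R) (hκ : 0 < κ)
    (hμ : 2048 * κ ≤ μ) : 17 * κ * R ^ 2 < K * μ * (supNorm R 0 (G (d := d))).toReal := by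
  have hμ0 : 0 < μ := by linarith
  calc 17 * κ * R ^ 2 < 256 * κ * R ^ 2 := by gcongr; norm_num
    _ = 1 * (2048 * κ) * (R ^ 2 / 8) := by ring
    _ ≤ K * μ * (supNorm R 0 (G (d := d))).toReal := by
        gcongr
        exact sq_div_eight_le_supNorm_G hR

theorem lt_mul_supNorm_F (hd : 1 ≤ d) (p : ℕ) {K R ε μ : ℝ} (hK : 0 < K) (hR : 0 < R) (hε : 0 < ε)
    (hμ : 2048 * (ε * K) ≤ μ) :
    34 * (ε * K) ^ 2 * R ^ 2 < K * μ * (supNorm R 0 (F (d := d) p ε)).toReal := by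
  have hκ := mul_pos hε hK
  have hμ0 : 0 < μ := by linarith
  calc 34 * (ε * K) ^ 2 * R ^ 2 < 256 * (ε * K) ^ 2 * R ^ 2 := by gcongr; norm_num
    _ = K * (2048 * (ε * K)) * (ε * R ^ 2 / 8) := by ring
    _ ≤ K * μ * (supNorm R 0 (F (d := d) p ε)).toReal := by
        gcongr
        exact sq_div_eight_le_supNorm_F hd p hε.le hR

end KleinGordon

end

open KleinGordon

theorem theorem4 (d : ℕ) (hd : 1 ≤ d) :
    ∃ c : ℝ, 0 < c ∧ ∀ δ R : ℝ, 0 < δ → δ ≤ 1 / 4 → 0 < R → R < 1 →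
      ∃ εstar C : ℝ, 0 < εstar ∧ 0 < C ∧
        ∀ p : ℕ, 1 ≤ p → ∀ ε : ℝ, 0 < ε → ε < εstar →
        ∀ μ : ℝ, μ = KleinGordon.mu c R δ p ε →
          ∃ (T : KleinGordon.Phase d → KleinGordon.Phase d) (Z P : KleinGordon.Phase d → ℂ),
            KleinGordon.IsCanonical T (KleinGordon.ballRd d R δ) ∧
            (∀ z ∈ KleinGordon.ballRd d R δ, ‖T z - z‖ ≤ C * μ * R) ∧
            KleinGordon.ballRd d R (2 * δ) ⊆ T '' KleinGordon.ballRd d R δ ∧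
            T '' KleinGordon.ballRd d R δ ⊆ KleinGordon.ballRd d R 0 ∧
            KleinGordon.ballRd d R (3 * δ) ⊆ T '' KleinGordon.ballRd d R (2 * δ) ∧
            T '' KleinGordon.ballRd d R (2 * δ) ⊆ KleinGordon.ballRd d R δ ∧
            DifferentiableOn ℂ Z (KleinGordon.ballRd d R δ) ∧
            DifferentiableOn ℂ P (KleinGordon.ballRd d R δ) ∧
            (∀ z ∈ KleinGordon.ballRd d R δ, KleinGordon.IsReal z → (Z z).im = 0) ∧
            (∀ z ∈ KleinGordon.ballRd d R δ,
              KleinGordon.H p ε (T z) = KleinGordon.G z + Z z + P z) ∧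
            (∀ z ∈ KleinGordon.ballRd d R δ, KleinGordon.poisson KleinGordon.G Z z = 0) ∧
            KleinGordon.fieldNorm R δ P ≤ ENNReal.ofReal (μ * Real.exp (-(1 / μ))) ∧
            ∀ z₀ ∈ KleinGordon.ballRd d R (3 * δ), KleinGordon.IsReal z₀ →
              (∃ z : ℝ → KleinGordon.Phase d,
                KleinGordon.IsOrbit (KleinGordon.H p ε) (Real.exp (1 / μ)) z₀ z) ∧
              ∀ z : ℝ → KleinGordon.Phase d,
                KleinGordon.IsOrbit (KleinGordon.H p ε) (Real.exp (1 / μ)) z₀ z →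
                ∀ t : ℝ, |t| ≤ Real.exp (1 / μ) →
                  z t ∈ KleinGordon.ballRd d R δ ∧
                  ‖KleinGordon.G (z t) - KleinGordon.G z₀‖
                    < C * μ * (KleinGordon.supNorm R 0 (KleinGordon.G (d := d))).toReal ∧
                  ‖Z (z t) - Z z₀‖
                    < C * μ * (KleinGordon.supNorm R 0 (KleinGordon.F (d := d) p ε)).toReal := by
  have hK := one_le_couplingBound d
  have hK0 := couplingBound_pos d
  refine ⟨3 * couplingBound d, by positivity, fun δ R hδ hδ4 hR hR1 =>
    ⟨δ / (512 * couplingBound d), couplingBound d, by positivity, hK0,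
      fun p _ ε hε hεδ μ hμ => ?_⟩⟩
  have hκ := mul_pos hε hK0
  have hκδ : 512 * (ε * couplingBound d) ≤ δ := by linarith [(lt_div_iff₀ (by positivity)).1 hεδ]
  have hκμ := (mul_le_mu p hK0.le hR.le hδ hδ4 hε.le).trans_eq hμ.symm
  have hμ0 : 0 < μ := by linarith
  obtain ⟨q, N, Ψ, hΨ, hq0, hq⟩ := exists_normalForm_isChart p hR hR1.le hε hκδ
    ((le_mu p hK0.le hR.le hδ hε.le).trans_eq hμ.symm)
  have hδR := mul_pos hδ hR
  have hκR := mul_lt_mul_of_pos_right (show 8 * (ε * couplingBound d) < δ by linarith) hR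
  refine ⟨N.T, N.Z, N.P, isCanonical_T hΨ, fun z hz => (N.norm_T_sub_le z hz).trans ?_,
    hΨ.ball_subset_image_T (by linarith) (by linarith), N.image_T_ball_subset le_rfl (by linarith),
    hΨ.ball_subset_image_T (by linarith) (by linarith),
    N.image_T_ball_subset (by linarith) (by linarith), N.Z_hamiltonian.holo, N.P_hamiltonian.holo,
    fun z hz => im_eq_zero_of_isReal N.Z_hamiltonian hz, fun z hz => ?_,
    fun z hz => poisson_G_eq_zero (N.fderiv_Z_A z hz),
    fieldNorm_P_le N hR hμ0.le (by linarith) hq0 hq,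
    fun z₀ hz₀ hreal => ⟨exists_isOrbit hΨ hε.le hR hδ4 hκ.le (by linarith) hq0 hq hz₀ hreal,
      fun z hz t ht => ?_⟩⟩
  · have hμK : μ ≤ couplingBound d * μ := le_mul_of_one_le_left hμ0.le hK
    exact mul_le_mul_of_nonneg_right (by linarith) hR.le
  · rw [H_eq_energy_add, G_eq_energy]
    exact N.energy_T_add z hz
  · obtain ⟨hball, hG, hZ⟩ := hz.mem_ballRd_and_norm_sub_le hΨ hε.le hR hδ4 hκ.le (by linarith)
      hq0 hq hz₀ hreal (abs_le.1 ht)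
    exact ⟨hball, hG.trans_lt (lt_mul_supNorm_G hK hR hκ hκμ),
      hZ.trans_lt (lt_mul_supNorm_F hd p hK0 hR hε hκμ)⟩
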